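/- Let $\mathfrak A$ be a finite-dimensional real normed division algebra (that is, up to isomorphism, $\mathbb R$, $\mathbb C$, the quaternions or the octonions), with conjugation $x\mapsto\bar x$, and let $\beta=\dim_{\mathbb R}\mathfrak A\in\{1,2,4,8\}$. Let $1\le n<m$ be integers, and assume that $\mathfrak A$ is associative or $n\le 2$. **Notation.** Let $\mathfrak P_n$ be the cone of positive definite hermitian $n\times n$ matrices over $\mathfrak A$, $|A|$ the determinant of $A\in\mathfrak P_n$ (characterised by: $|A|^{\beta}$ is the determinant of the real-linear map $v\mapsto Av$ of $\mathfrak A^n$), $A_p$ the leading principal $p\times p$ submatrix of $A$, and, for $\kappa=(k_1,\dots,k_n)\in\mathbb R^n$, $$q_\kappa(A)=|A_n|^{k_n}\prod_{i=1}^{n-1}|A_i|^{k_i-k_{i+1}} .$$ Let $(dR)$ be Lebesgue measure on $\mathfrak A^{n\times m}$ and $(dS)=\prod_i ds_{ii}\prod_{i>j}ds_{ij}$ Lebesgue measure on the hermitian matrices, both in orthonormal coordinates of $\mathfrak A$. For real $a,b$ and $\kappa,\tau\in\mathbb R^n$ put $$\Gamma_n^\beta[a]=\int_{\mathfrak P_n}e^{-\operatorname{tr}A}|A|^{a-(n-1)\beta/2-1}(dA),$$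 $$\mathcal B_n^\beta[a,\kappa;b,\tau]=\int_{0<S<I_n}|S|^{a-(n-1)\beta/2-1}q_\kappa(S)\,|I_n-S|^{b-(n-1)\beta/2-1}q_\tau(I_n-S)\,(dS),$$ $$\mathcal B_n^\beta[a,-\kappa;b,-\tau]=\int_{0<S<I_n}|S|^{a-(n-1)\beta/2-1}q_\kappa(S^{-1})\,|I_n-S|^{b-(n-1)\beta/2-1}q_\tau((I_n-S)^{-1})\,(dS).$$ Let $a\in\mathbb R$, $\kappa_1,\tau_1\in\mathbb R^n$, let $R_1$ be a random $n\times m$ matrix over $\mathfrak A$, and let $B_1=R_1R_1^*$. 1. Suppose that $R_1$ has the (standardised) matricvariate Pearson type II-Riesz distribution of type I, that is, it has the density $$\frac{\Gamma_n^\beta[m\beta/2]}{\pi^{mn\beta/2}\,\mathcal B_n^\beta[a\beta/2,\kappa_1;m\beta/2,\tau_1]}\,|I_n-R_1R_1^*|^{(a-n+1)\beta/2-1}q_{\kappa_1}(I_n-R_1R_1^*)\,q_{\tau_1}(R_1R_1^*)$$ with respect to $(dR_1)$ on the set where $R_1R_1^*\in\mathfrak P_n$ and $I_n-R_1R_1^*\in\mathfrak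 P_n$ (and density $0$ elsewhere). Then $B_1\in\mathfrak P_n$ almost surely, and $B_1$ has the matricvariate c-beta-Riesz type I distribution: its density with respect to $(dB_1)$ is $$\frac{|B_1|^{(m-n+1)\beta/2-1}}{\mathcal B_n^\beta[a\beta/2,\kappa_1;m\beta/2,\tau_1]}\,|I_n-B_1|^{(a-n+1)\beta/2-1}\,q_{\kappa_1}(I_n-B_1)\,q_{\tau_1}(B_1)$$ on the set where $B_1\in\mathfrak P_n$ and $I_n-B_1\in\mathfrak P_n$, and $0$ elsewhere. 2. Suppose that $R_1$ has the (standardised) matricvariate Pearson type II-Riesz distribution of type II, that is, it has the density $$\frac{\Gamma_n^\beta[m\beta/2]}{\pi^{mn\beta/2}\,\mathcal B_n^\beta[a\beta/2,-\kappa_1;m\beta/2,-\tau_1]}\,|I_n-R_1R_1^*|^{(a-n+1)\beta/2-1}q_{\kappa_1}\big((I_n-R_1R_1^*)^{-1}\big)\,q_{\tau_1}\big((R_1R_1^*)^{-1}\big)$$ on the same set. Then $B_1\in\mathfrak P_n$ almost surely, and $B_1$ has the matricvariate k-beta-Riesz type I distribution: its density with respect to $(dB_1)$ is $$\frac{|B_1|^{(m-n+1)\beta/2-1}}{\mathcal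 B_n^\beta[a\beta/2,-\kappa_1;m\beta/2,-\tau_1]}\,|I_n-B_1|^{(a-n+1)\beta/2-1}\,q_{\kappa_1}\big((I_n-B_1)^{-1}\big)\,q_{\tau_1}\big(B_1^{-1}\big)$$ on the set where $B_1\in\mathfrak P_n$ and $I_n-B_1\in\mathfrak P_n$, and $0$ elsewhere. -/

import Mathlib

open MeasureTheory Matrix

/-- A (finite-dimensional) real normed division algebra: a nonzero unital real algebra, not assumed
associative or commutative, with an inner product such that `(xy, xy) = (x, x) (y, y)`.
The star operation is the usual conjugation `x̄ = 2 (x, 1) 1 - x`.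
Up to isomorphism these are the real numbers, the complex numbers, the quaternions and the
octonions. -/
class RealNormedDivisionAlgebra (𝔸 : Type*) extends
    NonAssocRing 𝔸, StarRing 𝔸, NormedAddCommGroup 𝔸, InnerProductSpace ℝ 𝔸, Nontrivial 𝔸 where
  finiteDimensional : FiniteDimensional ℝ 𝔸
  smul_mul_eq : ∀ (r : ℝ) (x y : 𝔸), (r • x) * y = r • (x * y)
  mul_smul_eq : ∀ (r : ℝ) (x y : 𝔸), x * (r • y) = r • (x * y)
  inner_mul_self : ∀ x y : 𝔸, Inner.inner ℝ (x * y) (x * y) = Inner.inner ℝ x x * Inner.inner ℝ y y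
  star_eq : ∀ x : 𝔸, star x = (2 * Inner.inner ℝ x 1) • (1 : 𝔸) - x

namespace RealNormedDivisionAlgebra

attribute [instance] RealNormedDivisionAlgebra.finiteDimensional

/-- The real numbers, with their usual structure. -/
noncomputable abbrev ofReal : RealNormedDivisionAlgebra ℝ where
  __ := (inferInstance : InnerProductSpace ℝ ℝ)
  finiteDimensional := inferInstance
  smul_mul_eq r x y := by simp [mul_assoc]
  mul_smul_eq r x y := by simp [mul_left_comm]
  inner_mul_self x y := by simp only [real_inner_self_eq_norm_sq, norm_mul]; ring
  star_eq x := by simp; ring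

/-- The complex numbers, with their usual structure. -/
noncomputable abbrev ofComplex : RealNormedDivisionAlgebra ℂ where
  __ := (inferInstance : InnerProductSpace ℝ ℂ)
  finiteDimensional := inferInstance
  smul_mul_eq r x y := by simp [mul_assoc]
  mul_smul_eq r x y := by simp [mul_left_comm]
  inner_mul_self x y := by
    simp only [real_inner_self_eq_norm_sq, norm_mul]; ring
  star_eq x := by
    apply Complex.ext <;> simp [Complex.inner]; ring

/-- The quaternions, with their usual structure. -/
noncomputable abbrev ofQuaternion : RealNormedDivisionAlgebra (Quaternion ℝ) where
  __ := (inferInstance : InnerProductSpace ℝ (Quaternion ℝ))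
  finiteDimensional := inferInstance
  smul_mul_eq r x y := by simp
  mul_smul_eq r x y := by simp
  inner_mul_self x y := by
    simp only [real_inner_self_eq_norm_sq, norm_mul]; ring
  star_eq x := by
    have h : star x = (2 * (x * star (1 : Quaternion ℝ)).re) • (1 : Quaternion ℝ) - x := by
      apply Quaternion.ext <;>
        simp [Quaternion.re_one, Quaternion.imI_one, Quaternion.imJ_one, Quaternion.imK_one]
      ring
    exact h

end RealNormedDivisionAlgebra

namespace BetaRiesz

/-- Matrices carry the product σ-algebra of their entries. -/
instance matrixMeasurableSpace {m n α : Type*} [MeasurableSpace α] :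
    MeasurableSpace (Matrix m n α) :=
  inferInstanceAs (MeasurableSpace (m → n → α))

section Algebra

variable (𝔸 : Type*) [RealNormedDivisionAlgebra 𝔸]

/-- The parameter `β`, the real dimension of the algebra (1, 2, 4 or 8). -/
noncomputable def beta : ℝ := (Module.finrank ℝ 𝔸 : ℝ)

variable {𝔸}

/-- Left multiplication `v ↦ A v` by a square matrix, as a real linear map on column vectors. -/
def leftMul {n : ℕ} (A : Matrix (Fin n) (Fin n) 𝔸) : (Fin n → 𝔸) →ₗ[ℝ] (Fin n → 𝔸) where
  toFun v := A *ᵥ v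
  map_add' v w := Matrix.mulVec_add A v w
  map_smul' r v := by
    funext i
    simp [Matrix.mulVec, dotProduct, Finset.smul_sum, RealNormedDivisionAlgebra.mul_smul_eq]

/-- The determinant `|A|`, used below for positive definite `A` only. Each (real) eigenvalue of such
an `A` has real multiplicity `β` as an eigenvalue of `v ↦ A v`, so the determinant of that real
linear map is `|A| ^ β`. Over the reals this is the usual determinant, over the complex numbers the
usual determinant (a positive number), over the quaternions the Moore determinant, and for
a 2 × 2 octonion hermitian matrix `a₁₁ a₂₂ - ‖a₁₂‖²`. -/
noncomputable def hdet {n : ℕ} (A : Matrix (Fin n) (Fin n) 𝔸) : ℝ :=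
  (LinearMap.det (leftMul A)) ^ (1 / beta 𝔸)

/-- The real trace (for hermitian `A` the diagonal entries are real multiples of `1`). -/
noncomputable def rtrace {n : ℕ} (A : Matrix (Fin n) (Fin n) 𝔸) : ℝ :=
  ∑ i, inner ℝ (A i i) (1 : 𝔸)

/-- Membership in the cone of positive definite matrices: `A = A*` and `v* A v > 0` for `v ≠ 0`,
where `v* A v = Re (∑ i, v̄ᵢ (A v)ᵢ) = ∑ i, (vᵢ, (A v)ᵢ)`. -/
def PosDef {n : ℕ} (A : Matrix (Fin n) (Fin n) 𝔸) : Prop :=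
  A.IsHermitian ∧ ∀ v : Fin n → 𝔸, v ≠ 0 → 0 < ∑ i, inner ℝ (v i) ((A *ᵥ v) i)

open Classical in
/-- The inverse matrix: the two-sided inverse if there is one, and `0` otherwise. -/
noncomputable def minv {n : ℕ} (A : Matrix (Fin n) (Fin n) 𝔸) : Matrix (Fin n) (Fin n) 𝔸 :=
  if h : ∃ C : Matrix (Fin n) (Fin n) 𝔸, A * C = 1 ∧ C * A = 1 then h.choose else 0

/-- The leading principal submatrix `A_p = (a_rs)`, `r, s = 1, …, p`, with `p = i + 1`. -/
def leading {n : ℕ} (A : Matrix (Fin n) (Fin n) 𝔸) (i : Fin n) :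
    Matrix (Fin (i.val + 1)) (Fin (i.val + 1)) 𝔸 :=
  A.submatrix (Fin.castLE i.isLt) (Fin.castLE i.isLt)

/-- The highest weight vector (generalised power)
`q_κ(A) = |A_n| ^ k_n * ∏_{i < n} |A_i| ^ (k_i - k_{i+1})`. -/
noncomputable def q {n : ℕ} (κ : Fin n → ℝ) (A : Matrix (Fin n) (Fin n) 𝔸) : ℝ :=
  ∏ i : Fin n, hdet (leading A i) ^
    (κ i - if h : i.val + 1 < n then κ ⟨i.val + 1, h⟩ else 0)

end Algebra

section Analysis

variable (𝔸 : Type*) [RealNormedDivisionAlgebra 𝔸] [MeasurableSpace 𝔸] [BorelSpace 𝔸]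

/-- Lebesgue measure `(dX)` on `n × m` matrices: the product over all entries of the Lebesgue
measure of `𝔸` (in which a unit cube on an orthonormal basis has measure one). -/
noncomputable def matVol (n m : ℕ) : Measure (Matrix (Fin n) (Fin m) 𝔸) :=
  Measure.pi (fun _ : Fin n => Measure.pi (fun _ : Fin m => (volume : Measure 𝔸)))

/-- The index set of the entries strictly below the diagonal. -/
abbrev Below (n : ℕ) : Type := {p : Fin n × Fin n // p.2 < p.1}

variable {𝔸} in
/-- The hermitian matrix with the given real diagonal and the given entries below the diagonal. -/
def hermOf {n : ℕ} (x : (Fin n → ℝ) × (Below n → 𝔸)) : Matrix (Fin n) (Fin n) 𝔸 :=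
  Matrix.of fun i j =>
    if h : j < i then x.2 ⟨(i, j), h⟩
    else if h' : i < j then star (x.2 ⟨(j, i), h'⟩)
    else x.1 i • (1 : 𝔸)

/-- Lebesgue measure `(dS)` on hermitian matrices, in the coordinates `s_ii` and `s_ij`, `i > j`;
it is carried by the hermitian matrices inside the space of all square matrices. -/
noncomputable def hermVol (n : ℕ) : Measure (Matrix (Fin n) (Fin n) 𝔸) :=
  Measure.map hermOf
    ((Measure.pi (fun _ : Fin n => (volume : Measure ℝ))).prod
      (Measure.pi (fun _ : Below n => (volume : Measure 𝔸))))

/-- The multivariate gamma function `Γ_n[a]`. -/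
noncomputable def multiGamma (n : ℕ) (a : ℝ) : ℝ :=
  ∫ A in {A : Matrix (Fin n) (Fin n) 𝔸 | PosDef A},
    Real.exp (-rtrace A) * hdet A ^ (a - (n - 1) * beta 𝔸 / 2 - 1) ∂(hermVol 𝔸 n)

/-- The generalised c-beta function `B_n[a, κ; b, τ]`. -/
noncomputable def cBeta {n : ℕ} (a : ℝ) (κ : Fin n → ℝ) (b : ℝ) (τ : Fin n → ℝ) : ℝ :=
  ∫ S in {S : Matrix (Fin n) (Fin n) 𝔸 | PosDef S ∧ PosDef (1 - S)},
    hdet S ^ (a - (n - 1) * beta 𝔸 / 2 - 1) * q κ S *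
      (hdet (1 - S) ^ (b - (n - 1) * beta 𝔸 / 2 - 1) * q τ (1 - S)) ∂(hermVol 𝔸 n)

/-- The generalised k-beta function `B_n[a, -κ; b, -τ]`. -/
noncomputable def kBeta {n : ℕ} (a : ℝ) (κ : Fin n → ℝ) (b : ℝ) (τ : Fin n → ℝ) : ℝ :=
  ∫ S in {S : Matrix (Fin n) (Fin n) 𝔸 | PosDef S ∧ PosDef (1 - S)},
    hdet S ^ (a - (n - 1) * beta 𝔸 / 2 - 1) * q κ (minv S) *
      (hdet (1 - S) ^ (b - (n - 1) * beta 𝔸 / 2 - 1) * q τ (minv (1 - S))) ∂(hermVol 𝔸 n)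

variable {𝔸}

/-- `X` is a random element whose law has the density `f` with respect to `μ`. -/
def HasDensity {Ω E : Type*} [MeasurableSpace Ω] [MeasurableSpace E] (P : Measure Ω) (X : Ω → E)
    (μ : Measure E) (f : E → ℝ) : Prop :=
  AEMeasurable X P ∧ P.map X = μ.withDensity (fun x => ENNReal.ofReal (f x))

open Classical in
/-- The density of the matricvariate Pearson type II-Riesz distribution of type I with parameters
`(a, κ, τ, 0, I, I)` on `n × m` matrices. -/
noncomputable def pearsonRieszDensityI {n m : ℕ} (a : ℝ) (κ τ : Fin n → ℝ)
    (R : Matrix (Fin n) (Fin m) 𝔸) : ℝ :=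
  if PosDef (R * Rᴴ) ∧ PosDef (1 - R * Rᴴ) then
    multiGamma 𝔸 n (m * beta 𝔸 / 2) /
        (Real.pi ^ (m * n * beta 𝔸 / 2) * cBeta 𝔸 (a * beta 𝔸 / 2) κ (m * beta 𝔸 / 2) τ) *
      hdet (1 - R * Rᴴ) ^ ((a - n + 1) * beta 𝔸 / 2 - 1) *
      q κ (1 - R * Rᴴ) * q τ (R * Rᴴ)
  else 0

open Classical in
/-- The density of the matricvariate Pearson type II-Riesz distribution of type II with parameters
`(a, κ, τ, 0, I, I)` on `n × m` matrices. -/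
noncomputable def pearsonRieszDensityII {n m : ℕ} (a : ℝ) (κ τ : Fin n → ℝ)
    (R : Matrix (Fin n) (Fin m) 𝔸) : ℝ :=
  if PosDef (R * Rᴴ) ∧ PosDef (1 - R * Rᴴ) then
    multiGamma 𝔸 n (m * beta 𝔸 / 2) /
        (Real.pi ^ (m * n * beta 𝔸 / 2) * kBeta 𝔸 (a * beta 𝔸 / 2) κ (m * beta 𝔸 / 2) τ) *
      hdet (1 - R * Rᴴ) ^ ((a - n + 1) * beta 𝔸 / 2 - 1) *
      q κ (minv (1 - R * Rᴴ)) * q τ (minv (R * Rᴴ))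
  else 0

open Classical in
/-- The matricvariate c-beta-Riesz type I density on `n × n` positive definite matrices. -/
noncomputable def cBetaRieszDensity {n : ℕ} (m : ℕ) (a : ℝ) (κ τ : Fin n → ℝ)
    (B : Matrix (Fin n) (Fin n) 𝔸) : ℝ :=
  if PosDef B ∧ PosDef (1 - B) then
    hdet B ^ ((m - n + 1) * beta 𝔸 / 2 - 1) /
        cBeta 𝔸 (a * beta 𝔸 / 2) κ (m * beta 𝔸 / 2) τ *
      hdet (1 - B) ^ ((a - n + 1) * beta 𝔸 / 2 - 1) *
      q κ (1 - B) * q τ B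
  else 0

open Classical in
/-- The matricvariate k-beta-Riesz type I density on `n × n` positive definite matrices. -/
noncomputable def kBetaRieszDensity {n : ℕ} (m : ℕ) (a : ℝ) (κ τ : Fin n → ℝ)
    (B : Matrix (Fin n) (Fin n) 𝔸) : ℝ :=
  if PosDef B ∧ PosDef (1 - B) then
    hdet B ^ ((m - n + 1) * beta 𝔸 / 2 - 1) /
        kBeta 𝔸 (a * beta 𝔸 / 2) κ (m * beta 𝔸 / 2) τ *
      hdet (1 - B) ^ ((a - n + 1) * beta 𝔸 / 2 - 1) *
      q κ (minv (1 - B)) * q τ (minv B)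
  else 0

end Analysis

end BetaRiesz

/-! Both parts follow from one fact: for n ≤ m, the map R ↦ R R* carries Lebesgue measure on n × m
matrices to the measure with density (π^(mnβ/2) / Γ_n[mβ/2]) |B|^((m-n+1)β/2-1) on the positive
definite cone (`lintegral_mul_conjTranspose`). Each given density depends on R only through R R*, so
it passes to B = R R* multiplied by that weight (`HasDensity.mul_conjTranspose`), and the gamma and
π factors cancel.

The fact is proved up to a constant by induction on the number of rows
(`exists_lintegral_mul_conjTranspose`). If a first row r is added to R and x = r̄, then R R* is
bordered by s = ‖x‖² and the column y = R x. For fixed R of full rank, split x along ker R and its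
orthogonal complement: ‖x‖² = t + y*(R R*)⁻¹y, where t is the squared norm of a vector in a space of
real dimension (m-n)β and y has Jacobian |R R*|^(-β/2) (`lintegral_mulVec_norm_sq`). On the
hermitian side t = s - y*A⁻¹y is the Schur complement; it decides positivity and multiplies the
determinant (`posDef_bordered_iff`, `hdet_bordered`). The powers of |A| and t then match. The
constant is found by testing on exp(-tr B): one side is a Gaussian integral, the other is Γ_n[mβ/2].

Associativity enters only through the n × n block being bordered. When the full size is at most 2,
this block has size at most 1 and its entry is real, so x(x̄y) = ‖x‖²y is enough. Inverses are taken
as real linear maps, which avoids any need for an inverse matrix over 𝔸. -/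

namespace RealNormedDivisionAlgebra

/-! ### Identities in a composition algebra -/

variable {𝔸 : Type*} [RealNormedDivisionAlgebra 𝔸]

theorem norm_mul_eq (x y : 𝔸) : ‖x * y‖ = ‖x‖ * ‖y‖ := by
  have h := inner_mul_self x y
  simp only [real_inner_self_eq_norm_sq] at h
  rw [← mul_pow] at h
  exact (sq_eq_sq₀ (norm_nonneg _) (by positivity)).1 h

theorem norm_one_eq : ‖(1 : 𝔸)‖ = 1 := by
  obtain ⟨x, hx⟩ := exists_ne (0 : 𝔸)
  have h := norm_mul_eq 1 x
  rw [one_mul] at h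
  exact (mul_right_cancel₀ (norm_ne_zero_iff.2 hx) (by rw [one_mul]; exact h)).symm

theorem inner_mul_mul_left (x y z : 𝔸) : inner ℝ (x * y) (x * z) = ‖x‖ ^ 2 * inner ℝ y z := by
  have h := norm_mul_eq x (y + z)
  have h1 : ‖x * y + x * z‖ ^ 2 = ‖x‖ ^ 2 * ‖y + z‖ ^ 2 := by rw [← mul_add, h, mul_pow]
  rw [norm_add_sq_real, norm_add_sq_real, norm_mul_eq, norm_mul_eq] at h1
  linarith

theorem inner_mul_mul_right (x y z : 𝔸) : inner ℝ (x * z) (y * z) = inner ℝ x y * ‖z‖ ^ 2 := by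
  have h := norm_mul_eq (x + y) z
  have h1 : ‖x * z + y * z‖ ^ 2 = ‖x + y‖ ^ 2 * ‖z‖ ^ 2 := by rw [← add_mul, h, mul_pow]
  rw [norm_add_sq_real, norm_add_sq_real, norm_mul_eq, norm_mul_eq] at h1
  linarith

/-- The full polarisation of ‖xy‖ = ‖x‖‖y‖. Taking z = 1 yields the adjoint of left multiplication.
-/
theorem inner_mul_mul_exchange (x y z w : 𝔸) :
    inner ℝ (x * y) (z * w) + inner ℝ (x * w) (z * y) = 2 * inner ℝ x z * inner ℝ y w := by
  have h := inner_mul_mul_right x z (y + w)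
  rw [norm_add_sq_real] at h
  simp only [mul_add, inner_add_left, inner_add_right, inner_mul_mul_right] at h
  linarith

/-- This adjointness needs no associativity: it is the exchange identity at z = 1 combined with x̄ =
2(x, 1) - x. -/
theorem inner_mul_left (x y z : 𝔸) : inner ℝ (x * y) z = inner ℝ y (star x * z) := by
  have h := inner_mul_mul_exchange x y 1 z
  rw [one_mul, one_mul] at h
  rw [star_eq, sub_mul, smul_mul_eq, one_mul, inner_sub_right, inner_smul_right,
    real_inner_comm (x * z) y]
  linarith

theorem inner_star_star (x y : 𝔸) : inner ℝ (star x) (star y) = inner ℝ x y := by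
  rw [star_eq, star_eq]
  simp only [inner_sub_left, inner_sub_right, inner_smul_left, inner_smul_right,
    real_inner_self_eq_norm_sq, norm_one_eq]
  rw [real_inner_comm y 1]
  simp
  ring

theorem norm_star_eq (x : 𝔸) : ‖star x‖ = ‖x‖ := by
  have h := inner_star_star x x
  simp only [real_inner_self_eq_norm_sq] at h
  exact (sq_eq_sq₀ (norm_nonneg _) (norm_nonneg _)).1 h

/-- Pair with an arbitrary z and move x̄ across the inner product. This replaces associativity in
the octonion case. -/
theorem star_mul_mul_self (x y : 𝔸) : star x * (x * y) = ‖x‖ ^ 2 • y := by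
  refine ext_inner_right ℝ fun z => ?_
  rw [inner_mul_left, star_star, inner_mul_mul_left, inner_smul_left]
  rfl

theorem mul_star_mul_self (x y : 𝔸) : x * (star x * y) = ‖x‖ ^ 2 • y := by
  have h := star_mul_mul_self (star x) y
  rwa [star_star, norm_star_eq] at h

theorem mul_star_self_eq (x : 𝔸) : x * star x = ‖x‖ ^ 2 • (1 : 𝔸) := by
  simpa using mul_star_mul_self x 1

theorem star_smul_eq (r : ℝ) (x : 𝔸) : star (r • x) = r • star x := by
  rw [star_eq, star_eq, inner_smul_left, smul_sub, smul_smul]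
  congr 2
  simp; ring

theorem eq_smul_one_of_star_eq {x : 𝔸} (h : star x = x) : x = inner ℝ x 1 • (1 : 𝔸) := by
  rw [star_eq, sub_eq_iff_eq_add, ← two_smul ℝ x, mul_smul] at h
  exact (smul_right_injective 𝔸 (two_ne_zero' ℝ) h).symm

theorem inner_smul_one_one (r : ℝ) : inner ℝ (r • (1 : 𝔸)) 1 = r := by
  rw [inner_smul_left, real_inner_self_eq_norm_sq, norm_one_eq]; simp

/-- Conjugation as a linear isometry. -/
noncomputable def starIsometry : 𝔸 ≃ₗᵢ[ℝ] 𝔸 where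
  toFun := star
  invFun := star
  left_inv := star_star
  right_inv := star_star
  map_add' := star_add
  map_smul' := star_smul_eq
  norm_map' := norm_star_eq

theorem continuous_mul_pair : Continuous fun p : 𝔸 × 𝔸 => p.1 * p.2 := by
  let M : 𝔸 →ₗ[ℝ] 𝔸 →ₗ[ℝ] 𝔸 := LinearMap.mk₂ ℝ (fun x y : 𝔸 => x * y)
    add_mul smul_mul_eq mul_add mul_smul_eq
  exact (M.mkContinuous₂ 1 fun x y => by
    simp [M, norm_mul_eq]).continuous₂

instance : ContinuousMul 𝔸 := ⟨continuous_mul_pair⟩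

instance : ContinuousStar 𝔸 := ⟨starIsometry.continuous⟩

end RealNormedDivisionAlgebra

/-! ### Matrices acting on column vectors -/

namespace BetaRiesz

open RealNormedDivisionAlgebra

variable {𝔸 : Type*} [RealNormedDivisionAlgebra 𝔸]

theorem leftMul_apply {n : ℕ} (A : Matrix (Fin n) (Fin n) 𝔸) (v : Fin n → 𝔸) :
    leftMul A v = A *ᵥ v := rfl

/-- Left multiplication of column vectors by a rectangular matrix, as a real linear map. -/
def rectMul {n m : ℕ} (R : Matrix (Fin n) (Fin m) 𝔸) : (Fin m → 𝔸) →ₗ[ℝ] (Fin n → 𝔸) where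
  toFun v := R *ᵥ v
  map_add' v w := Matrix.mulVec_add R v w
  map_smul' r v := by
    funext i
    simp [Matrix.mulVec, dotProduct, Finset.smul_sum, mul_smul_eq]

theorem sum_inner_mulVec {n m : ℕ} (R : Matrix (Fin n) (Fin m) 𝔸) (v : Fin m → 𝔸)
    (w : Fin n → 𝔸) :
    ∑ i, inner ℝ ((R *ᵥ v) i) (w i) = ∑ k, inner ℝ (v k) ((Rᴴ *ᵥ w) k) := by
  simp only [mulVec, dotProduct, sum_inner, inner_sum, conjTranspose_apply, inner_mul_left]
  exact Finset.sum_comm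

theorem mulVec_mul_right (hA : ∀ x y z : 𝔸, (x * y) * z = x * (y * z)) {n m : ℕ}
    (A : Matrix (Fin n) (Fin m) 𝔸) (v : Fin m → 𝔸) (u : 𝔸) :
    (A *ᵥ fun j => v j * u) = fun i => (A *ᵥ v) i * u := by
  funext i
  simp only [mulVec, dotProduct, Finset.sum_mul, hA]

/-- In the nonassociative case the only entry is self-conjugate, hence real, and real scalars
associate with everything. -/
theorem IsHermitian.mulVec_mul_right {n : ℕ}
    (h : (∀ x y z : 𝔸, (x * y) * z = x * (y * z)) ∨ n ≤ 1) {A : Matrix (Fin n) (Fin n) 𝔸}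
    (hA : A.IsHermitian) (v : Fin n → 𝔸) (u : 𝔸) :
    (A *ᵥ fun j => v j * u) = fun i => (A *ᵥ v) i * u := by
  rcases h with h | h
  · exact BetaRiesz.mulVec_mul_right h A v u
  · have : Subsingleton (Fin n) := Fin.subsingleton_iff_le_one.2 h
    funext i
    have hr := eq_smul_one_of_star_eq (hA.apply i i)
    have hs : Fintype.card (Fin n) = 1 := Fintype.card_eq_one_iff.2 ⟨i, fun j => Subsingleton.elim _ _⟩
    simp only [mulVec, dotProduct]
    rw [Fintype.sum_subsingleton _ i, Fintype.sum_subsingleton _ i, hr]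
    simp only [smul_mul_eq, one_mul]

/-- For a single row, r_k (r̄_k v) = ‖r_k‖² v for each k, so the sum is R R* acting as a real
scalar. -/
theorem mulVec_conjTranspose_mulVec {n m : ℕ}
    (h : (∀ x y z : 𝔸, (x * y) * z = x * (y * z)) ∨ n ≤ 1) (R : Matrix (Fin n) (Fin m) 𝔸)
    (v : Fin n → 𝔸) : R *ᵥ (Rᴴ *ᵥ v) = (R * Rᴴ) *ᵥ v := by
  rcases h with h | h
  · funext i
    simp only [mulVec, dotProduct, Matrix.mul_apply, Finset.sum_mul, Finset.mul_sum, h]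
    exact Finset.sum_comm
  · have : Subsingleton (Fin n) := Fin.subsingleton_iff_le_one.2 h
    funext i
    simp only [mulVec, dotProduct, Matrix.mul_apply]
    rw [Fintype.sum_subsingleton _ i, Finset.sum_mul]
    refine Finset.sum_congr rfl fun k _ => ?_
    rw [Fintype.sum_subsingleton _ i, conjTranspose_apply, mul_star_mul_self, mul_star_self_eq,
      smul_mul_eq, one_mul]

theorem isHermitian_mul_conjTranspose {n m : ℕ} (R : Matrix (Fin n) (Fin m) 𝔸) :
    (R * Rᴴ).IsHermitian := by
  ext i j
  simp [Matrix.mul_apply, star_sum]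

end BetaRiesz

/-! ### Polar coordinates and linear images of Lebesgue measure -/

section Real

open Set Module

/-- Polar coordinates for functions of the squared norm. -/
theorem lintegral_comp_norm_sq (K : Type*) [NormedAddCommGroup K] [InnerProductSpace ℝ K]
    [FiniteDimensional ℝ K] [MeasurableSpace K] [BorelSpace K] [Nontrivial K] :
    ∃ c : ENNReal, c ≠ 0 ∧ c ≠ ⊤ ∧ ∀ h : ℝ → ENNReal, Measurable h →
      ∫⁻ x : K, h (‖x‖ ^ 2) =
        c * ∫⁻ t in Ioi (0 : ℝ), ENNReal.ofReal (t ^ ((finrank ℝ K : ℝ) / 2 - 1)) * h t := by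
  set μ : Measure K := volume
  have hk : 0 < finrank ℝ K := finrank_pos
  -- The surface measure of the unit sphere, times the 1/2 that comes from substituting t = r².
  refine ⟨μ.toSphere univ * 2⁻¹, ?_, ?_, fun h hh => ?_⟩
  · simp only [ne_eq, mul_eq_zero, Measure.measure_univ_eq_zero, Measure.toSphere_ne_zero,
      false_or, ENNReal.inv_eq_zero]
    simp
  · exact ENNReal.mul_ne_top (measure_ne_top _ _) (by simp)
  have e1 : ∫⁻ x : K, h (‖x‖ ^ 2) =
      ∫⁻ x : ({(0)}ᶜ : Set K), h (‖x.1‖ ^ 2) ∂(μ.comap (↑)) := by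
    rw [lintegral_subtype_comap (measurableSet_singleton _).compl fun x => h (‖x‖ ^ 2),
      restrict_compl_singleton]
  have hm : Measurable fun x : Ioi (0 : ℝ) => h (x.1 ^ 2) := by fun_prop
  have e2 : ∫⁻ x : ({(0)}ᶜ : Set K), h (‖x.1‖ ^ 2) ∂(μ.comap (↑)) =
      ∫⁻ p, h (p.2.1 ^ 2) ∂(μ.toSphere.prod (.volumeIoiPow (finrank ℝ K - 1))) := by
    rw [← μ.measurePreserving_homeomorphUnitSphereProd.lintegral_comp
      (f := fun p => h (p.2.1 ^ 2)) (hm.comp measurable_snd)]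
    simp
  have e3 : ∫⁻ p, h (p.2.1 ^ 2) ∂(μ.toSphere.prod (.volumeIoiPow (finrank ℝ K - 1))) =
      μ.toSphere univ * ∫⁻ x : Ioi (0 : ℝ), h (x.1 ^ 2) ∂(.volumeIoiPow (finrank ℝ K - 1)) := by
    rw [lintegral_prod _ (by exact (hm.comp measurable_snd).aemeasurable)]
    simp [mul_comm]
  have e4 : ∫⁻ x : Ioi (0 : ℝ), h (x.1 ^ 2) ∂(.volumeIoiPow (finrank ℝ K - 1)) =
      ∫⁻ r in Ioi (0 : ℝ), ENNReal.ofReal (r ^ (finrank ℝ K - 1)) * h (r ^ 2) := by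
    rw [Measure.volumeIoiPow, lintegral_withDensity_eq_lintegral_mul _ (by fun_prop) hm]
    exact lintegral_subtype_comap measurableSet_Ioi
      fun r => ENNReal.ofReal (r ^ (finrank ℝ K - 1)) * h (r ^ 2)
  have him : (fun r : ℝ => r ^ 2) '' Ioi 0 = Ioi 0 := by
    ext t
    simp only [mem_image, mem_Ioi]
    exact ⟨fun ⟨r, hr, h⟩ => h ▸ by positivity,
      fun ht => ⟨√t, Real.sqrt_pos.2 ht, Real.sq_sqrt ht.le⟩⟩
  have e5 := lintegral_image_eq_lintegral_abs_deriv_mul (f := fun r : ℝ => r ^ 2)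
    (f' := fun r => 2 * r) measurableSet_Ioi
    (fun x _ => by simpa using (hasDerivAt_pow 2 x).hasDerivWithinAt)
    (fun x hx y hy hxy => (sq_eq_sq₀ (le_of_lt hx) (le_of_lt hy)).1 hxy)
    (fun t => ENNReal.ofReal (t ^ ((finrank ℝ K : ℝ) / 2 - 1)) * h t)
  rw [him] at e5
  rw [e1, e2, e3, e4, e5, mul_assoc]
  congr 1
  rw [← lintegral_const_mul _ (by fun_prop)]
  refine setLIntegral_congr_fun measurableSet_Ioi fun r hr => ?_
  have hr : 0 < r := hr
  rw [← mul_assoc, ← mul_assoc, ← ENNReal.ofReal_ofNat, ← ENNReal.ofReal_inv_of_pos two_pos,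
    ← ENNReal.ofReal_mul (by positivity), ← ENNReal.ofReal_mul (by positivity)]
  congr 2
  rw [abs_of_pos (by positivity), ← Real.rpow_natCast r 2, ← Real.rpow_mul hr.le,
    ← Real.rpow_natCast r, Nat.cast_sub hk]
  have : r ^ ((finrank ℝ K : ℝ) - (1 : ℕ)) = r * r ^ ((2 : ℕ) * ((finrank ℝ K : ℝ) / 2 - 1)) := by
    nth_rw 2 [← Real.rpow_one r]
    rw [← Real.rpow_add hr]
    congr 1
    push_cast; ring
  rw [this]; ring

variable {E F : Type*} [NormedAddCommGroup E] [InnerProductSpace ℝ E] [FiniteDimensional ℝ E]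
  [MeasurableSpace E] [BorelSpace E] [NormedAddCommGroup F] [InnerProductSpace ℝ F]
  [FiniteDimensional ℝ F] [MeasurableSpace F] [BorelSpace F]

/-- An isometric parametrisation of the domain of a surjective linear map by the kernel directions
and the codomain. -/
theorem exists_measurePreserving_of_surjective (T : E →ₗ[ℝ] F) (hT : Function.Surjective T) :
    ∃ φ : EuclideanSpace ℝ (Fin (finrank ℝ E - finrank ℝ F)) × F → E,
      ∃ V : F ≃ₗᵢ[ℝ] (LinearMap.ker T)ᗮ, MeasurePreserving φ ∧
        ∀ p, T (φ p) = T (V p.2) ∧ ‖φ p‖ ^ 2 = ‖p.1‖ ^ 2 + ‖p.2‖ ^ 2 := by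
  set K := LinearMap.ker T
  have h1 : finrank ℝ F + finrank ℝ K = finrank ℝ E := by
    rw [← LinearMap.finrank_range_add_finrank_ker T, LinearMap.range_eq_top.2 hT, finrank_top]
  have h2 : finrank ℝ K + finrank ℝ Kᗮ = finrank ℝ E := K.finrank_add_finrank_orthogonal
  -- Any isometry will do: only the dimensions have to agree, and `V` need not be related to `T`.
  let V : F ≃ₗᵢ[ℝ] Kᗮ := (stdOrthonormalBasis ℝ F).equiv (stdOrthonormalBasis ℝ Kᗮ)
    (finCongr (by omega))
  let W : EuclideanSpace ℝ (Fin (finrank ℝ E - finrank ℝ F)) ≃ₗᵢ[ℝ] K :=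
    (EuclideanSpace.basisFun _ ℝ).equiv (stdOrthonormalBasis ℝ K) (finCongr (by omega))
  refine ⟨fun p => K.orthogonalDecomposition.symm (WithLp.toLp 2 (W p.1, V p.2)), V, ?_, ?_⟩
  · exact K.orthogonalDecomposition.symm.measurePreserving.comp
      ((WithLp.volume_preserving_toLp K Kᗮ).comp (W.measurePreserving.prod V.measurePreserving))
  · intro p
    have hp : K.orthogonalDecomposition.symm (WithLp.toLp 2 (W p.1, V p.2)) =
        (W p.1 : E) + V p.2 := by
      rw [LinearIsometryEquiv.symm_apply_eq, map_add,
        Submodule.orthogonalDecomposition_apply, Submodule.orthogonalDecomposition_apply]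
      simp [← WithLp.toLp_add]
    dsimp only
    constructor
    · rw [hp, map_add, LinearMap.mem_ker.1 (W p.1).2, zero_add]
    · rw [LinearIsometryEquiv.norm_map, WithLp.prod_norm_sq_eq_of_L2]
      simp

/-- The joint distribution of `T x` and `‖x‖ ^ 2` for a surjective linear map `T`, where `T'` is the
adjoint of `T` and `H` inverts `T T'`. -/
theorem lintegral_linearMap_norm_sq (E F : Type*) [NormedAddCommGroup E] [InnerProductSpace ℝ E]
    [FiniteDimensional ℝ E] [MeasurableSpace E] [BorelSpace E] [NormedAddCommGroup F]
    [InnerProductSpace ℝ F] [FiniteDimensional ℝ F] [MeasurableSpace F] [BorelSpace F]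
    (hEF : finrank ℝ F < finrank ℝ E) :
    ∃ c : ENNReal, c ≠ 0 ∧ c ≠ ⊤ ∧ ∀ (T : E →ₗ[ℝ] F) (T' : F →ₗ[ℝ] E) (H : F →ₗ[ℝ] F),
      (∀ x y, inner ℝ (T x) y = inner ℝ x (T' y)) → (T ∘ₗ T') ∘ₗ H = LinearMap.id →
      ∀ g : F × ℝ → ENNReal, Measurable g →
      ∫⁻ x, g (T x, ‖x‖ ^ 2) = c * ENNReal.ofReal (LinearMap.det (T ∘ₗ T') ^ (-(1 / 2) : ℝ)) *
        ∫⁻ y, ∫⁻ t in Ioi (0 : ℝ),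
          ENNReal.ofReal (t ^ (((finrank ℝ E - finrank ℝ F : ℕ) : ℝ) / 2 - 1)) *
            g (y, t + inner ℝ y (H y)) := by
  set K₀ := EuclideanSpace ℝ (Fin (finrank ℝ E - finrank ℝ F))
  have hk : finrank ℝ K₀ = finrank ℝ E - finrank ℝ F := by simp [K₀]
  have : Nontrivial K₀ := Module.nontrivial_of_finrank_pos (R := ℝ) (by omega)
  obtain ⟨c, hc0, hct, hc⟩ := lintegral_comp_norm_sq K₀
  refine ⟨c, hc0, hct, fun T T' H hT' hH g hg => ?_⟩
  have hTH : ∀ y, T (T' (H y)) = y := fun y => LinearMap.congr_fun hH y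
  obtain ⟨φ, V, hφ, hφV⟩ := exists_measurePreserving_of_surjective T fun y => ⟨_, hTH y⟩
  -- `T` on the complement of its kernel, read through `V`: now an endomorphism, so it has a
  -- determinant.
  let S : F →ₗ[ℝ] F := T ∘ₗ (LinearMap.ker T)ᗮ.subtype ∘ₗ V.toLinearEquiv.toLinearMap
  have hS : ∀ z, S z = T (V z) := fun z => rfl
  have hT'mem : ∀ y, T' y ∈ (LinearMap.ker T)ᗮ := fun y x hx => by
    rw [← hT', LinearMap.mem_ker.1 hx, inner_zero_left]
  have hnorm : ∀ z, ‖z‖ ^ 2 = inner ℝ (S z) (H (S z)) := fun z => by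
    -- Both sides are orthogonal to the kernel and have the same image under `T`.
    have hV : (V z : E) = T' (H (S z)) := by
      have hd : (V z : E) - T' (H (S z)) ∈ LinearMap.ker T ⊓ (LinearMap.ker T)ᗮ :=
        ⟨by simp [hTH, hS], Submodule.sub_mem _ (V z).2 (hT'mem _)⟩
      rw [Submodule.inf_orthogonal_eq_bot, Submodule.mem_bot, sub_eq_zero] at hd
      exact hd
    rw [hS, hT', ← hS, ← hV, ← Submodule.coe_inner, V.inner_map_map, real_inner_self_eq_norm_sq]
  have hadj : ∀ y, (V (LinearMap.adjoint S y) : E) = T' y := fun y => by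
    rw [← sub_eq_zero, ← inner_self_eq_zero (𝕜 := ℝ)]
    set d := (V (LinearMap.adjoint S y) : E) - T' y with hd
    have hdm : d ∈ (LinearMap.ker T)ᗮ := Submodule.sub_mem _ (V _).2 (hT'mem _)
    obtain ⟨z, hz⟩ := V.surjective ⟨d, hdm⟩
    have hz' : d = V z := by rw [hz]
    nth_rw 2 [hz']
    rw [hd, inner_sub_left, ← Submodule.coe_inner, V.inner_map_map, LinearMap.adjoint_inner_left,
      real_inner_comm _ (T' y), ← hT', ← hS, real_inner_comm, sub_self]
  have hSS : T ∘ₗ T' = S ∘ₗ LinearMap.adjoint S := by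
    ext y
    simp only [LinearMap.comp_apply, hS, hadj]
  -- Hence the Jacobian |det S|⁻¹ of y = S z is the power -1/2 of det (T T'), whatever `V` was
  -- chosen.
  have hdetS : LinearMap.det (T ∘ₗ T') = LinearMap.det S ^ 2 := by
    rw [hSS, LinearMap.det_comp, ← LinearMap.det_toMatrix (stdOrthonormalBasis ℝ F).toBasis
      (LinearMap.adjoint S), LinearMap.toMatrix_adjoint, Matrix.det_conjTranspose,
      LinearMap.det_toMatrix, sq]
    simp
  have hdet0 : LinearMap.det S ≠ 0 := fun h0 => by
    have := congrArg LinearMap.det hH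
    rw [LinearMap.det_comp, hdetS, h0] at this
    simp at this
  have hdet : LinearMap.det (T ∘ₗ T') ^ (-(1 / 2) : ℝ) = |(LinearMap.det S)⁻¹| := by
    rw [hdetS, Real.rpow_neg (sq_nonneg _), ← Real.sqrt_eq_rpow, Real.sqrt_sq_eq_abs, abs_inv]
  have hTm : Measurable T := T.continuous_of_finiteDimensional.measurable
  have hHm : Measurable H := H.continuous_of_finiteDimensional.measurable
  have hSm : Measurable S := S.continuous_of_finiteDimensional.measurable
  rw [← hφ.lintegral_comp (f := fun x => g (T x, ‖x‖ ^ 2)) (by fun_prop)]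
  let N : F → ENNReal := fun y => ∫⁻ t in Ioi (0 : ℝ),
      ENNReal.ofReal (t ^ (((finrank ℝ E - finrank ℝ F : ℕ) : ℝ) / 2 - 1)) *
        g (y, t + inner ℝ y (H y))
  have hN : Measurable N := by
    refine Measurable.lintegral_prod_right' (f := fun p : F × ℝ =>
      ENNReal.ofReal (p.2 ^ (((finrank ℝ E - finrank ℝ F : ℕ) : ℝ) / 2 - 1)) *
        g (p.1, p.2 + inner ℝ p.1 (H p.1))) ?_
    fun_prop
  calc ∫⁻ p : K₀ × F, g (T (φ p), ‖φ p‖ ^ 2)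
      = ∫⁻ p : K₀ × F, g (S p.2, ‖p.1‖ ^ 2 + ‖p.2‖ ^ 2) := by
        refine lintegral_congr fun p => ?_
        rw [(hφV p).1, (hφV p).2, hS]
    _ = ∫⁻ z : F, ∫⁻ w : K₀, g (S z, ‖w‖ ^ 2 + ‖z‖ ^ 2) := by
        rw [Measure.volume_eq_prod, lintegral_prod_symm' _ (by fun_prop)]
    _ = ∫⁻ z : F, c * ∫⁻ t in Ioi (0 : ℝ),
          ENNReal.ofReal (t ^ (((finrank ℝ E - finrank ℝ F : ℕ) : ℝ) / 2 - 1)) *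
            g (S z, t + inner ℝ (S z) (H (S z))) := by
        refine lintegral_congr fun z => ?_
        rw [hc (fun t => g (S z, t + ‖z‖ ^ 2)) (by fun_prop), hk, hnorm]
    _ = _ := by
        rw [lintegral_const_mul c (f := fun z => N (S z)) (hN.comp hSm), mul_assoc, hdet]
        congr 1
        rw [← lintegral_map hN hSm, Measure.map_linearMap_addHaar_eq_smul_addHaar _ hdet0,
          lintegral_smul_measure, smul_eq_mul]

end Real

/-! ### Schur complements and bordered hermitian matrices -/

theorem LinearMap.det_prod_of_schur {M N : Type*} [AddCommGroup M] [Module ℝ M]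
    [FiniteDimensional ℝ M] [AddCommGroup N] [Module ℝ N] [FiniteDimensional ℝ N]
    (a : M →ₗ[ℝ] M) (k' : N →ₗ[ℝ] M) (k : M →ₗ[ℝ] N) (g h : N →ₗ[ℝ] N) (t : ℝ)
    (hgh : g ∘ₗ h = LinearMap.id) (ht : a - k' ∘ₗ h ∘ₗ k = t • LinearMap.id) :
    LinearMap.det ((a.coprod k').prod (k.coprod g)) =
      LinearMap.det g * t ^ Module.finrank ℝ M := by
  classical
  let b := Module.finBasis ℝ M
  let d := Module.finBasis ℝ N
  have hm : LinearMap.toMatrix (b.prod d) (b.prod d) ((a.coprod k').prod (k.coprod g)) =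
      fromBlocks (LinearMap.toMatrix b b a) (LinearMap.toMatrix d b k')
        (LinearMap.toMatrix b d k) (LinearMap.toMatrix d d g) := by
    ext i j
    rcases i with i | i <;> rcases j with j | j <;> simp [LinearMap.toMatrix_apply]
  have hG : LinearMap.toMatrix d d g * LinearMap.toMatrix d d h = 1 := by
    rw [← LinearMap.toMatrix_comp, hgh, LinearMap.toMatrix_id]
  have := invertibleOfRightInverse _ _ hG
  have hinv : ⅟(LinearMap.toMatrix d d g) = LinearMap.toMatrix d d h :=
    invOf_eq_right_inv hG
  rw [← LinearMap.det_toMatrix (b.prod d), hm, det_fromBlocks₂₂, hinv,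
    ← LinearMap.toMatrix_comp, ← LinearMap.toMatrix_comp, ← map_sub, LinearMap.comp_assoc, ht,
    LinearMap.det_toMatrix, map_smul, LinearMap.toMatrix_id, Matrix.det_smul]
  simp

namespace BetaRiesz

open RealNormedDivisionAlgebra

variable {𝔸 : Type*} [RealNormedDivisionAlgebra 𝔸]

/-- The inverse of left multiplication by `A`, and `0` if there is none. -/
noncomputable def leftInv {n : ℕ} (A : Matrix (Fin n) (Fin n) 𝔸) :
    (Fin n → 𝔸) →ₗ[ℝ] (Fin n → 𝔸) :=
  Ring.inverse (M₀ := Module.End ℝ (Fin n → 𝔸)) (leftMul A)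

/-- The quadratic form `y* A⁻¹ y`. -/
noncomputable def invForm {n : ℕ} (A : Matrix (Fin n) (Fin n) 𝔸) (y : Fin n → 𝔸) : ℝ :=
  ∑ i, inner ℝ (y i) (leftInv A y i)

theorem PosDef.isUnit_leftMul {n : ℕ} {A : Matrix (Fin n) (Fin n) 𝔸} (hA : PosDef A) :
    IsUnit (M := Module.End ℝ (Fin n → 𝔸)) (leftMul A) := by
  rw [Module.End.isUnit_iff]
  suffices hi : Function.Injective (leftMul A) from ⟨hi, LinearMap.injective_iff_surjective.1 hi⟩
  refine (injective_iff_map_eq_zero _).2 fun v hv => by_contra fun h => ?_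
  have h1 := hA.2 v h
  rw [← leftMul_apply, hv] at h1
  simp at h1

theorem PosDef.leftMul_comp_leftInv {n : ℕ} {A : Matrix (Fin n) (Fin n) 𝔸} (hA : PosDef A) :
    leftMul A ∘ₗ leftInv A = LinearMap.id :=
  Ring.mul_inverse_cancel _ hA.isUnit_leftMul

theorem PosDef.mulVec_leftInv {n : ℕ} {A : Matrix (Fin n) (Fin n) 𝔸} (hA : PosDef A)
    (v : Fin n → 𝔸) : A *ᵥ leftInv A v = v :=
  LinearMap.congr_fun hA.leftMul_comp_leftInv v

theorem PosDef.mulVec_injective {n : ℕ} {A : Matrix (Fin n) (Fin n) 𝔸} (hA : PosDef A) :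
    Function.Injective fun v => A *ᵥ v :=
  ((Module.End.isUnit_iff _).1 hA.isUnit_leftMul).1

theorem PosDef.leftInv_mul_right {n : ℕ} {A : Matrix (Fin n) (Fin n) 𝔸}
    (h : (∀ x y z : 𝔸, (x * y) * z = x * (y * z)) ∨ n ≤ 1) (hA : PosDef A)
    (y : Fin n → 𝔸) (u : 𝔸) : (leftInv A fun i => y i * u) = fun i => leftInv A y i * u := by
  apply hA.mulVec_injective
  dsimp only
  rw [hA.mulVec_leftInv, IsHermitian.mulVec_mul_right h hA.1, hA.mulVec_leftInv]

theorem PosDef.sum_inner_leftInv_comm {n : ℕ} {A : Matrix (Fin n) (Fin n) 𝔸} (hA : PosDef A)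
    (y z : Fin n → 𝔸) :
    ∑ i, inner ℝ (y i) (leftInv A z i) = ∑ i, inner ℝ (leftInv A y i) (z i) := by
  have h := sum_inner_mulVec A (leftInv A y) (leftInv A z)
  rwa [hA.1.eq, hA.mulVec_leftInv, hA.mulVec_leftInv] at h

theorem PosDef.invForm_mul_right {n : ℕ} {A : Matrix (Fin n) (Fin n) 𝔸}
    (h : (∀ x y z : 𝔸, (x * y) * z = x * (y * z)) ∨ n ≤ 1) (hA : PosDef A)
    (y : Fin n → 𝔸) (u : 𝔸) : invForm A (fun i => y i * u) = invForm A y * ‖u‖ ^ 2 := by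
  simp only [invForm, hA.leftInv_mul_right h, inner_mul_mul_right, Finset.sum_mul]

/-- Polarise `PosDef.invForm_mul_right` in u, using the symmetry of A⁻¹. This makes the Schur
complement, as a real linear map of 𝔸, a real multiple of the identity. -/
theorem PosDef.sum_star_mul_leftInv {n : ℕ} {A : Matrix (Fin n) (Fin n) 𝔸}
    (h : (∀ x y z : 𝔸, (x * y) * z = x * (y * z)) ∨ n ≤ 1) (hA : PosDef A)
    (y : Fin n → 𝔸) (u : 𝔸) :
    ∑ i, star (y i) * leftInv A (fun j => y j * u) i = invForm A y • u := by
  refine ext_inner_left ℝ fun w => ?_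
  have hb : ∀ w u, inner ℝ w (∑ i, star (y i) * leftInv A (fun j => y j * u) i) =
      ∑ i, inner ℝ (y i * w) (leftInv A (fun j => y j * u) i) := fun w u => by
    simp only [inner_sum, inner_mul_left]
  have h1 := hA.invForm_mul_right h y (w + u)
  have h2 := hA.invForm_mul_right h y w
  have h3 := hA.invForm_mul_right h y u
  have h4 := hA.sum_inner_leftInv_comm (fun i => y i * w) (fun i => y i * u)
  have h5 : (fun i => y i * (w + u)) = (fun i => y i * w) + fun i => y i * u := by
    funext i; exact mul_add _ _ _
  rw [h5, norm_add_sq_real] at h1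
  simp only [invForm, map_add, Pi.add_apply, inner_add_left, inner_add_right,
    Finset.sum_add_distrib] at h1 h2 h3
  rw [hb, inner_smul_right]
  have h6 : ∑ i, inner ℝ (y i * u) (leftInv A (fun i => y i * w) i) =
      ∑ i, inner ℝ (leftInv A (fun i => y i * w) i) (y i * u) :=
    Finset.sum_congr rfl fun i _ => real_inner_comm _ _
  rw [h6, ← h4] at h1
  simp only [invForm]
  linarith

/-- The hermitian matrix with first column `(s, y)` and lower right block `A`. -/
def bordered {n : ℕ} (s : ℝ) (y : Fin n → 𝔸) (A : Matrix (Fin n) (Fin n) 𝔸) :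
    Matrix (Fin (n + 1)) (Fin (n + 1)) 𝔸 :=
  Matrix.of (Fin.cons (Fin.cons (s • (1 : 𝔸)) (star y)) fun i => Fin.cons (y i) (A i))

section bordered

variable {n : ℕ} (s : ℝ) (y : Fin n → 𝔸) (A : Matrix (Fin n) (Fin n) 𝔸)

@[simp] theorem bordered_zero_zero : bordered s y A 0 0 = s • (1 : 𝔸) := rfl

@[simp] theorem bordered_zero_succ (j : Fin n) : bordered s y A 0 j.succ = star (y j) := rfl

@[simp] theorem bordered_succ_zero (i : Fin n) : bordered s y A i.succ 0 = y i := rfl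

@[simp] theorem bordered_succ_succ (i j : Fin n) : bordered s y A i.succ j.succ = A i j := rfl

theorem isHermitian_bordered_iff : (bordered s y A).IsHermitian ↔ A.IsHermitian := by
  constructor
  · intro h
    ext i j
    exact h.apply i.succ j.succ
  · intro h
    ext i j
    cases i using Fin.cases <;> cases j using Fin.cases <;>
      simp [star_smul_eq, h.apply]

theorem bordered_mulVec_zero (u : 𝔸) (v : Fin n → 𝔸) :
    (bordered s y A *ᵥ Fin.cons u v) 0 = s • u + ∑ j, star (y j) * v j := by
  simp [mulVec, dotProduct, Fin.sum_univ_succ, smul_mul_eq]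

theorem bordered_mulVec_succ (u : 𝔸) (v : Fin n → 𝔸) (i : Fin n) :
    (bordered s y A *ᵥ Fin.cons u v) i.succ = y i * u + (A *ᵥ v) i := by
  simp [mulVec, dotProduct, Fin.sum_univ_succ]

theorem sum_inner_bordered (u : 𝔸) (v : Fin n → 𝔸) :
    ∑ i, inner ℝ (Fin.cons (α := fun _ => 𝔸) u v i) ((bordered s y A *ᵥ Fin.cons u v) i) =
      s * ‖u‖ ^ 2 + 2 * ∑ i, inner ℝ (v i) (y i * u) + ∑ i, inner ℝ (v i) ((A *ᵥ v) i) := by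
  rw [Fin.sum_univ_succ]
  simp only [Fin.cons_zero, Fin.cons_succ, bordered_mulVec_zero, bordered_mulVec_succ,
    inner_add_right, inner_smul_right, inner_sum, Finset.sum_add_distrib,
    real_inner_self_eq_norm_sq, ← inner_mul_left]
  have : ∑ i, inner ℝ (y i * u) (v i) = ∑ i, inner ℝ (v i) (y i * u) :=
    Finset.sum_congr rfl fun i _ => real_inner_comm _ _
  rw [this]; ring

variable {s y A}

/-- Completing the square in v. -/
theorem sum_inner_bordered_eq (h : (∀ x y z : 𝔸, (x * y) * z = x * (y * z)) ∨ n ≤ 1)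
    (hA : PosDef A) (u : 𝔸) (v : Fin n → 𝔸) :
    ∑ i, inner ℝ (Fin.cons (α := fun _ => 𝔸) u v i) ((bordered s y A *ᵥ Fin.cons u v) i) =
      (s - invForm A y) * ‖u‖ ^ 2 + ∑ i, inner ℝ ((v + leftInv A fun j => y j * u) i)
        ((A *ᵥ (v + leftInv A fun j => y j * u)) i) := by
  rw [sum_inner_bordered]
  simp only [mulVec_add, hA.mulVec_leftInv, Pi.add_apply, inner_add_left, inner_add_right,
    Finset.sum_add_distrib]
  have h1 := hA.invForm_mul_right h y u
  have h2 := hA.sum_inner_leftInv_comm (fun i => y i * u) (fun i => y i * u)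
  have h3 := sum_inner_mulVec A (leftInv A fun j => y j * u) v
  simp only [hA.1.eq, hA.mulVec_leftInv] at h3
  have h4 : ∑ i, inner ℝ (y i * u) (v i) = ∑ i, inner ℝ (v i) (y i * u) :=
    Finset.sum_congr rfl fun i _ => real_inner_comm _ _
  simp only [invForm] at h1 ⊢
  linarith

theorem posDef_bordered_iff (h : (∀ x y z : 𝔸, (x * y) * z = x * (y * z)) ∨ n ≤ 1) :
    PosDef (bordered s y A) ↔ PosDef A ∧ 0 < s - invForm A y := by
  constructor
  · intro hB
    have hA : PosDef A := by
      refine ⟨(isHermitian_bordered_iff s y A).1 hB.1, fun v hv => ?_⟩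
      have := hB.2 (Fin.cons 0 v) fun h0 => hv (funext fun i => by
        simpa using congrFun h0 i.succ)
      rw [sum_inner_bordered] at this
      simpa using this
    refine ⟨hA, ?_⟩
    -- The vector (1, -A⁻¹y) makes the completed square vanish, so only the Schur complement
    -- remains.
    have := hB.2 (Fin.cons 1 (-leftInv A fun j => y j * 1)) fun h0 => one_ne_zero (α := 𝔸) (by
      simpa using congrFun h0 0)
    rw [sum_inner_bordered_eq h hA] at this
    simpa [norm_one_eq] using this
  · rintro ⟨hA, ht⟩
    refine ⟨(isHermitian_bordered_iff s y A).2 hA.1, fun w hw => ?_⟩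
    obtain ⟨u, v, rfl⟩ : ∃ u v, w = Fin.cons u v := ⟨w 0, Fin.tail w, (Fin.cons_self_tail w).symm⟩
    rw [sum_inner_bordered_eq h hA]
    by_cases hu : u = 0
    · subst hu
      have hz : (leftInv A fun j => y j * 0) = 0 := by
        have : (fun j => y j * (0 : 𝔸)) = 0 := by funext j; simp
        rw [this, map_zero]
      rw [hz, add_zero]
      have := hA.2 v fun hv => hw (by subst hv; funext i; cases i using Fin.cases <;> simp)
      simpa using this
    · have h1 : 0 < (s - invForm A y) * ‖u‖ ^ 2 := by positivity
      refine add_pos_of_pos_of_nonneg h1 ?_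
      by_cases hz : (v + leftInv A fun j => y j * u) = 0
      · rw [hz]; simp
      · exact (hA.2 _ hz).le

theorem det_leftMul_bordered (h : (∀ x y z : 𝔸, (x * y) * z = x * (y * z)) ∨ n ≤ 1)
    (hA : PosDef A) : LinearMap.det (leftMul (bordered s y A)) =
      LinearMap.det (leftMul A) * (s - invForm A y) ^ Module.finrank ℝ 𝔸 := by
  let k : 𝔸 →ₗ[ℝ] (Fin n → 𝔸) :=
    { toFun := fun u i => y i * u
      map_add' := fun u v => funext fun i => mul_add _ _ _
      map_smul' := fun r u => funext fun i => mul_smul_eq _ _ _ }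
  let k' : (Fin n → 𝔸) →ₗ[ℝ] 𝔸 :=
    { toFun := fun v => ∑ j, star (y j) * v j
      map_add' := fun u v => by simp [mul_add, Finset.sum_add_distrib]
      map_smul' := fun r u => by simp [mul_smul_eq, Finset.smul_sum] }
  have hs : s • LinearMap.id - k' ∘ₗ leftInv A ∘ₗ k =
      (s - invForm A y) • (LinearMap.id : 𝔸 →ₗ[ℝ] 𝔸) := by
    ext u
    simp only [LinearMap.sub_apply, LinearMap.smul_apply, LinearMap.id_apply,
      LinearMap.comp_apply, sub_smul]
    congr 1
    exact hA.sum_star_mul_leftInv h y u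
  rw [← LinearMap.det_prod_of_schur _ k' k _ _ _ hA.leftMul_comp_leftInv hs,
    ← LinearMap.det_conj _ (Fin.consLinearEquiv ℝ fun _ : Fin (n + 1) => 𝔸).symm]
  congr 1
  refine LinearMap.ext fun p => ?_
  obtain ⟨u, v⟩ := p
  have : (Fin.consLinearEquiv ℝ fun _ : Fin (n + 1) => 𝔸) (u, v) = Fin.cons u v := rfl
  simp only [LinearMap.comp_apply, LinearEquiv.coe_coe, LinearEquiv.symm_symm, this]
  rw [LinearEquiv.symm_apply_eq]
  funext i
  rw [leftMul_apply]
  cases i using Fin.cases with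
  | zero => exact bordered_mulVec_zero s y A u v
  | succ i => exact bordered_mulVec_succ s y A u v i

theorem isHermitian_eq_bordered {B : Matrix (Fin (n + 1)) (Fin (n + 1)) 𝔸}
    (hB : B.IsHermitian) : B = bordered (inner ℝ (B 0 0) 1) (fun i => B i.succ 0)
      (B.submatrix Fin.succ Fin.succ) := by
  ext i j
  cases i using Fin.cases with
  | zero =>
    cases j using Fin.cases with
    | zero => exact eq_smul_one_of_star_eq (hB.apply 0 0)
    | succ j => exact (hB.apply 0 j.succ).symm
  | succ i => cases j using Fin.cases <;> rfl

end bordered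

theorem PosDef.det_leftMul_pos {n : ℕ} (h : (∀ x y z : 𝔸, (x * y) * z = x * (y * z)) ∨ n ≤ 2)
    {A : Matrix (Fin n) (Fin n) 𝔸} (hA : PosDef A) : 0 < LinearMap.det (leftMul A) := by
  induction n with
  | zero =>
    rw [LinearMap.det_eq_one_of_subsingleton]
    exact one_pos
  | succ n ih =>
    -- Size at most 2 for the whole matrix leaves size at most 1 for the block, as the bordering
    -- lemmas require.
    have h' : (∀ x y z : 𝔸, (x * y) * z = x * (y * z)) ∨ n ≤ 1 := h.imp_right (by omega)
    obtain ⟨s, y, A', rfl⟩ : ∃ s y A', A = bordered s y A' :=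
      ⟨_, _, _, isHermitian_eq_bordered hA.1⟩
    obtain ⟨h1, h2⟩ := (posDef_bordered_iff h').1 hA
    rw [det_leftMul_bordered h' h1]
    exact mul_pos (ih (h.imp_right (by omega)) h1) (pow_pos h2 _)

theorem beta_pos : 0 < beta 𝔸 := Nat.cast_pos.2 Module.finrank_pos

theorem PosDef.hdet_pos {n : ℕ} (h : (∀ x y z : 𝔸, (x * y) * z = x * (y * z)) ∨ n ≤ 2)
    {A : Matrix (Fin n) (Fin n) 𝔸} (hA : PosDef A) : 0 < hdet A :=
  Real.rpow_pos_of_pos (hA.det_leftMul_pos h) _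

theorem PosDef.det_leftMul_eq {n : ℕ} (h : (∀ x y z : 𝔸, (x * y) * z = x * (y * z)) ∨ n ≤ 2)
    {A : Matrix (Fin n) (Fin n) 𝔸} (hA : PosDef A) :
    LinearMap.det (leftMul A) = hdet A ^ beta 𝔸 := by
  rw [hdet, ← Real.rpow_mul (hA.det_leftMul_pos h).le, one_div_mul_cancel beta_pos.ne',
    Real.rpow_one]

/-- The real determinant gains the factor (s - y*A⁻¹y)^β; its β-th root can be taken factor by
factor because nothing is negative. -/
theorem hdet_bordered {n : ℕ} {s : ℝ} {y : Fin n → 𝔸} {A : Matrix (Fin n) (Fin n) 𝔸}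
    (h : (∀ x y z : 𝔸, (x * y) * z = x * (y * z)) ∨ n ≤ 1)
    (hA : PosDef A) (ht : 0 ≤ s - invForm A y) :
    hdet (bordered s y A) = hdet A * (s - invForm A y) := by
  have hd := hA.det_leftMul_pos (h.imp_right (by omega))
  rw [hdet, det_leftMul_bordered h hA, Real.mul_rpow hd.le (pow_nonneg ht _), ← hdet,
    ← Real.rpow_natCast, ← Real.rpow_mul ht]
  congr 1
  change _ ^ (beta 𝔸 * (1 / beta 𝔸)) = _
  rw [mul_one_div_cancel beta_pos.ne', Real.rpow_one]

end BetaRiesz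

/-! ### Measurability -/

namespace BetaRiesz

open RealNormedDivisionAlgebra Module

theorem measurable_matrix_iff {α 𝔸 : Type*} [MeasurableSpace α] [MeasurableSpace 𝔸] {n m : ℕ}
    {f : α → Matrix (Fin n) (Fin m) 𝔸} : Measurable f ↔ ∀ i j, Measurable fun a => f a i j :=
  measurable_pi_iff.trans <| forall_congr' fun _ => measurable_pi_iff

variable {𝔸 : Type*} [RealNormedDivisionAlgebra 𝔸]

/-- The real matrix of left multiplication by `A` in a fixed basis. -/
noncomputable def realMatrix {n : ℕ} (A : Matrix (Fin n) (Fin n) 𝔸) :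
    Matrix (Fin (finrank ℝ (Fin n → 𝔸))) (Fin (finrank ℝ (Fin n → 𝔸))) ℝ :=
  LinearMap.toMatrix (finBasis ℝ (Fin n → 𝔸)) (finBasis ℝ (Fin n → 𝔸)) (leftMul A)

theorem continuous_realMatrix (n : ℕ) :
    Continuous (realMatrix : Matrix (Fin n) (Fin n) 𝔸 → _) := by
  refine continuous_matrix fun i j => ?_
  simp only [realMatrix, LinearMap.toMatrix_apply, leftMul_apply, ← Basis.coord_apply]
  exact (LinearMap.continuous_of_finiteDimensional _).comp
    (continuous_id.matrix_mulVec continuous_const)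

/-- Both inverses are 0 when there is none, so the equality holds for every A; measurability then
follows from the formula det⁻¹ · adjugate. -/
theorem leftInv_eq_toLin {n : ℕ} (A : Matrix (Fin n) (Fin n) 𝔸) :
    leftInv A =
      (LinearMap.toMatrixAlgEquiv (finBasis ℝ (Fin n → 𝔸))).symm (realMatrix A)⁻¹ := by
  rw [Matrix.nonsing_inv_eq_ringInverse]
  set e := LinearMap.toMatrixAlgEquiv (finBasis ℝ (Fin n → 𝔸))
  have h : realMatrix A = e (leftMul A) := rfl
  rw [h, leftInv]
  by_cases hu : IsUnit (M := Module.End ℝ (Fin n → 𝔸)) (leftMul A)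
  · obtain ⟨u, hu⟩ := hu
    have h2 : e (leftMul A) = (Units.mapEquiv e.toMulEquiv u).val := by rw [← hu]; rfl
    rw [h2, Ring.inverse_unit, ← hu, Ring.inverse_unit, AlgEquiv.eq_symm_apply]
    rfl
  · rw [Ring.inverse_non_unit _ hu, Ring.inverse_non_unit _ fun h => hu ?_, map_zero]
    simpa using h.map e.symm

/-- The only candidate for the inverse matrix of a positive definite matrix. -/
noncomputable def invCandidate {n : ℕ} (A : Matrix (Fin n) (Fin n) 𝔸) :
    Matrix (Fin n) (Fin n) 𝔸 :=
  Matrix.of fun i j => leftInv A (Pi.single j (1 : 𝔸)) i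

/-- The j-th column of C solves A c = e_j, which has only one solution; associativity is not
involved. -/
theorem PosDef.eq_invCandidate {n : ℕ} {A C : Matrix (Fin n) (Fin n) 𝔸} (hA : PosDef A)
    (h : A * C = 1) : C = invCandidate A := by
  ext i j
  have : (fun k => C k j) = leftInv A (Pi.single j 1) := by
    apply hA.mulVec_injective
    dsimp only
    rw [hA.mulVec_leftInv]
    funext k
    have := congrFun (congrFun h k) j
    rw [Matrix.mul_apply] at this
    rw [mulVec, dotProduct, this, Matrix.one_apply, Pi.single_apply]
  exact congrFun this i

open Classical in
theorem PosDef.minv_eq {n : ℕ} {A : Matrix (Fin n) (Fin n) 𝔸} (hA : PosDef A) :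
    minv A = if A * invCandidate A = 1 ∧ invCandidate A * A = 1 then invCandidate A else 0 := by
  rw [minv]
  split_ifs with h1 h2 h2
  · exact hA.eq_invCandidate h1.choose_spec.1
  · obtain ⟨C, hC⟩ := h1
    exact absurd (hA.eq_invCandidate hC.1 ▸ hC) h2
  · exact absurd ⟨_, h2⟩ h1
  · rfl

variable [MeasurableSpace 𝔸] [BorelSpace 𝔸]

instance matrixBorelSpace {n m : ℕ} : BorelSpace (Matrix (Fin n) (Fin m) 𝔸) :=
  inferInstanceAs (BorelSpace (Fin n → Fin m → 𝔸))

instance matrixSecondCountable {n m : ℕ} :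
    SecondCountableTopology (Matrix (Fin n) (Fin m) 𝔸) :=
  inferInstanceAs (SecondCountableTopology (Fin n → Fin m → 𝔸))

/-- Being hermitian is a closed condition. By homogeneity, positivity need only hold on the unit
sphere, and by compactness that is an open condition. -/
theorem measurableSet_posDef (n : ℕ) :
    MeasurableSet {A : Matrix (Fin n) (Fin n) 𝔸 | PosDef A} := by
  have h1 : IsClosed {A : Matrix (Fin n) (Fin n) 𝔸 | A.IsHermitian} :=
    isClosed_eq continuous_id.matrix_conjTranspose continuous_id
  have hc : Continuous fun p : Matrix (Fin n) (Fin n) 𝔸 × (Fin n → 𝔸) =>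
      ∑ i, inner ℝ (p.2 i) ((p.1 *ᵥ p.2) i) := by
    refine continuous_finsetSum _ fun i _ => ?_
    exact ((continuous_apply i).comp continuous_snd).inner
      ((continuous_apply i).comp (continuous_fst.matrix_mulVec continuous_snd))
  have h2 : IsOpen {A : Matrix (Fin n) (Fin n) 𝔸 | ∀ v ∈ Metric.sphere (0 : Fin n → 𝔸) 1,
      0 < ∑ i, inner ℝ (v i) ((A *ᵥ v) i)} := by
    rw [isOpen_iff_eventually]
    intro A hA
    exact (isCompact_sphere _ _).eventually_forall_of_forall_eventually fun v hv =>
      (hc.tendsto (A, v)).eventually (lt_mem_nhds (hA v hv))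
  convert h1.measurableSet.inter h2.measurableSet using 1
  ext A
  refine and_congr_right fun _ => ⟨fun h v hv => h v ?_, fun h v hv => ?_⟩
  · rintro rfl
    simp at hv
  · have hp : 0 < ‖v‖⁻¹ := inv_pos.2 (norm_pos_iff.2 hv)
    have := h (‖v‖⁻¹ • v) (by simp [norm_smul, norm_ne_zero_iff.2 hv])
    rw [← leftMul_apply, map_smul] at this
    simp only [Pi.smul_apply, inner_smul_left, inner_smul_right, ← Finset.mul_sum] at this
    exact (mul_pos_iff_of_pos_left hp).1 ((mul_pos_iff_of_pos_left hp).1 this)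

theorem measurable_hdet (n : ℕ) : Measurable (hdet : Matrix (Fin n) (Fin n) 𝔸 → ℝ) := by
  have : Continuous fun A : Matrix (Fin n) (Fin n) 𝔸 => LinearMap.det (leftMul A) := by
    simp only [← LinearMap.det_toMatrix (finBasis ℝ (Fin n → 𝔸))]
    exact (continuous_realMatrix n).matrix_det
  exact this.measurable.pow_const _

theorem measurable_q {n : ℕ} (κ : Fin n → ℝ) :
    Measurable (q κ : Matrix (Fin n) (Fin n) 𝔸 → ℝ) := by
  refine Finset.measurable_fun_prod _ fun i _ => Measurable.pow_const ?_ _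
  exact (measurable_hdet _).comp (continuous_id.matrix_submatrix _ _).measurable

theorem measurable_leftInv {n : ℕ} (v : Fin n → 𝔸) :
    Measurable fun A : Matrix (Fin n) (Fin n) 𝔸 => leftInv A v := by
  set b := finBasis ℝ (Fin n → 𝔸)
  have h : ∀ A : Matrix (Fin n) (Fin n) 𝔸, leftInv A v =
      ∑ i, ((realMatrix A).det⁻¹ * ((realMatrix A).adjugate *ᵥ b.repr v) i) • b i := by
    intro A
    rw [leftInv_eq_toLin]
    change Matrix.toLin b b _ v = _
    rw [Matrix.toLin_apply, Matrix.inv_def, Ring.inverse_eq_inv', Matrix.smul_mulVec]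
    rfl
  simp only [h]
  have hM := continuous_realMatrix (𝔸 := 𝔸) n
  refine Finset.measurable_fun_sum _ fun i _ => ?_
  have h1 : Measurable fun A : Matrix (Fin n) (Fin n) 𝔸 => (realMatrix A).det⁻¹ :=
    hM.matrix_det.measurable.inv
  have h2 : Measurable fun A : Matrix (Fin n) (Fin n) 𝔸 =>
      ((realMatrix A).adjugate *ᵥ b.repr v) i :=
    ((continuous_apply i).comp (hM.matrix_adjugate.matrix_mulVec continuous_const)).measurable
  exact (h1.mul h2).smul_const _

theorem measurable_invCandidate (n : ℕ) :
    Measurable (invCandidate : Matrix (Fin n) (Fin n) 𝔸 → _) :=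
  measurable_matrix_iff.2 fun i _ => (measurable_pi_apply i).comp (measurable_leftInv _)

theorem measurable_mul {n m k : ℕ} {α : Type*} [MeasurableSpace α]
    {f : α → Matrix (Fin n) (Fin m) 𝔸} {g : α → Matrix (Fin m) (Fin k) 𝔸} (hf : Measurable f)
    (hg : Measurable g) : Measurable fun a => f a * g a := by
  refine measurable_matrix_iff.2 fun i j => ?_
  simp only [Matrix.mul_apply]
  exact Finset.measurable_fun_sum _ fun l _ =>
    (measurable_matrix_iff.1 hf i l).mul (measurable_matrix_iff.1 hg l j)

/-- A measurable function that agrees with the inverse matrix on positive definite matrices. -/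
theorem exists_measurable_minv (𝔸 : Type*) [RealNormedDivisionAlgebra 𝔸] [MeasurableSpace 𝔸]
    [BorelSpace 𝔸] (n : ℕ) : ∃ g : Matrix (Fin n) (Fin n) 𝔸 → Matrix (Fin n) (Fin n) 𝔸,
      Measurable g ∧ ∀ A, PosDef A → minv A = g A := by
  classical
  refine ⟨_, Measurable.ite ?_ (measurable_invCandidate n) (measurable_const (a := (0 : Matrix (Fin n) (Fin n) 𝔸))),
    fun A hA => hA.minv_eq⟩
  exact (measurableSet_eq_fun (measurable_mul measurable_id (measurable_invCandidate n))
      measurable_const).inter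
    (measurableSet_eq_fun (measurable_mul (measurable_invCandidate n) measurable_id)
      measurable_const)

theorem measurable_mul_conjTranspose (n m : ℕ) :
    Measurable fun R : Matrix (Fin n) (Fin m) 𝔸 => R * Rᴴ :=
  (continuous_id.matrix_mul continuous_id.matrix_conjTranspose).measurable

/-- The map `toLp` multiplies Lebesgue measure by a constant. -/
theorem exists_map_toLp_eq_smul (𝔸 : Type*) [RealNormedDivisionAlgebra 𝔸] [MeasurableSpace 𝔸]
    [BorelSpace 𝔸] (n : ℕ) : ∃ c : ENNReal, c ≠ 0 ∧ c ≠ ⊤ ∧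
      (volume : Measure (Fin n → 𝔸)).map (WithLp.toLp 2) =
        c • (volume : Measure (PiLp 2 fun _ : Fin n => 𝔸)) := by
  let e : (Fin n → 𝔸) ≃L[ℝ] PiLp 2 fun _ : Fin n => 𝔸 :=
    (PiLp.continuousLinearEquiv 2 ℝ fun _ : Fin n => 𝔸).symm
  have : ((volume : Measure (Fin n → 𝔸)).map e).IsAddHaarMeasure :=
    e.isAddHaarMeasure_map _
  -- Uniqueness of Haar measure. The value of the constant is irrelevant, as the Gaussian integral
  -- fixes the overall one.
  refine ⟨_, ?_, ?_, Measure.isAddLeftInvariant_eq_smul (G := PiLp 2 fun _ : Fin n => 𝔸)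
    ((volume : Measure (Fin n → 𝔸)).map e) volume⟩
  · simpa using (Measure.addHaarScalarFactor_pos_of_isAddHaarMeasure _ _).ne'
  · exact ENNReal.coe_ne_top

end BetaRiesz

/-! ### Splitting off the first column; the joint law of R x and ‖x‖² -/

namespace BetaRiesz

open RealNormedDivisionAlgebra Module

variable {𝔸 : Type*} [RealNormedDivisionAlgebra 𝔸]

/-- The index set below the diagonal, split into the first column and the rest. -/
def belowSucc (n : ℕ) : Fin n ⊕ Below n ≃ Below (n + 1) where
  toFun := Sum.elim (fun i => ⟨(i.succ, 0), Fin.succ_pos i⟩)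
    fun p => ⟨(p.1.1.succ, p.1.2.succ), Fin.succ_lt_succ_iff.2 p.2⟩
  invFun p := Fin.cases (motive := fun j => j < p.1.1 → Fin n ⊕ Below n)
    (fun h => Sum.inl (p.1.1.pred (Fin.ne_zero_of_lt h)))
    (fun j h => Sum.inr ⟨(p.1.1.pred (Fin.ne_zero_of_lt h), j), by
      rw [← Fin.succ_lt_succ_iff, Fin.succ_pred]; exact h⟩) p.1.2 p.2
  left_inv p := by rcases p with i | p <;> simp
  right_inv p := by
    obtain ⟨⟨i, j⟩, h⟩ := p
    cases j using Fin.cases <;> simp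

theorem continuous_bordered (n : ℕ) : Continuous fun p : ℝ × (Fin n → 𝔸) ×
    Matrix (Fin n) (Fin n) 𝔸 => bordered p.1 p.2.1 p.2.2 := by
  refine continuous_matrix fun i j => ?_
  cases i using Fin.cases <;> cases j using Fin.cases <;> simp <;> fun_prop

/-- Only the values of w are prescribed, so that it can be the output of a measurable equivalence.
-/
theorem hermOf_cons (n : ℕ) (s : ℝ) (d : Fin n → ℝ) (y : Fin n → 𝔸) (b : Below n → 𝔸)
    (w : Below (n + 1) → 𝔸) (hy : ∀ i, w (belowSucc n (Sum.inl i)) = y i)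
    (hb : ∀ p, w (belowSucc n (Sum.inr p)) = b p) :
    hermOf (Fin.cons s d, w) = bordered s y (hermOf (d, b)) := by
  ext i j
  cases i using Fin.cases with
  | zero =>
    cases j using Fin.cases with
    | zero => simp [hermOf]
    | succ j =>
      simp only [hermOf, Matrix.of_apply, bordered_zero_succ, Fin.not_lt_zero, dite_false,
        Fin.succ_pos, dite_true]
      exact congrArg star (hy j)
  | succ i =>
    cases j using Fin.cases with
    | zero =>
      simp only [hermOf, Matrix.of_apply, bordered_succ_zero, Fin.succ_pos, dite_true]
      exact hy i
    | succ j =>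
      simp only [hermOf, Matrix.of_apply, bordered_succ_succ, Fin.succ_lt_succ_iff, Fin.cons_succ]
      split_ifs with h1 h2
      · exact hb ⟨(i, j), h1⟩
      · exact congrArg star (hb ⟨(j, i), h2⟩)
      · rfl

variable [MeasurableSpace 𝔸] [BorelSpace 𝔸]

theorem finrank_piLp (𝔸 : Type*) [RealNormedDivisionAlgebra 𝔸] (n : ℕ) :
    finrank ℝ (PiLp 2 fun _ : Fin n => 𝔸) = n * finrank ℝ 𝔸 := by
  rw [(WithLp.linearEquiv 2 ℝ (Fin n → 𝔸)).finrank_eq, finrank_pi_fintype]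
  simp

/-- The joint distribution of `R x` and `‖x‖ ^ 2` for a fixed matrix `R` of full row rank. -/
theorem lintegral_mulVec_norm_sq (𝔸 : Type*) [RealNormedDivisionAlgebra 𝔸] [MeasurableSpace 𝔸]
    [BorelSpace 𝔸] {n m : ℕ} (hnm : n < m)
    (h : (∀ x y z : 𝔸, (x * y) * z = x * (y * z)) ∨ n ≤ 1) :
    ∃ c : ENNReal, c ≠ 0 ∧ c ≠ ⊤ ∧ ∀ R : Matrix (Fin n) (Fin m) 𝔸, PosDef (R * Rᴴ) →
      ∀ g : (Fin n → 𝔸) × ℝ → ENNReal, Measurable g →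
      ∫⁻ x : Fin m → 𝔸, g (R *ᵥ x, ∑ k, ‖x k‖ ^ 2) =
        c * ENNReal.ofReal (hdet (R * Rᴴ) ^ (-(beta 𝔸 / 2))) * ∫⁻ y : Fin n → 𝔸,
          ∫⁻ t in Set.Ioi (0 : ℝ), ENNReal.ofReal (t ^ ((m - n) * beta 𝔸 / 2 - 1)) *
            g (y, t + invForm (R * Rᴴ) y) := by
  have hdim : 0 < finrank ℝ 𝔸 := finrank_pos
  have hEF : finrank ℝ (PiLp 2 fun _ : Fin n => 𝔸) < finrank ℝ (PiLp 2 fun _ : Fin m => 𝔸) := by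
    rw [finrank_piLp, finrank_piLp]
    exact Nat.mul_lt_mul_of_pos_right hnm hdim
  have hexp : ((finrank ℝ (PiLp 2 fun _ : Fin m => 𝔸) -
      finrank ℝ (PiLp 2 fun _ : Fin n => 𝔸) : ℕ) : ℝ) = (m - n) * beta 𝔸 := by
    rw [Nat.cast_sub hEF.le, finrank_piLp, finrank_piLp, beta]
    push_cast; ring
  obtain ⟨c, hc0, hct, hc⟩ := lintegral_linearMap_norm_sq
    (PiLp 2 fun _ : Fin m => 𝔸) (PiLp 2 fun _ : Fin n => 𝔸) hEF
  obtain ⟨cm, hcm0, hcmt, hcm⟩ := exists_map_toLp_eq_smul 𝔸 m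
  obtain ⟨cn, hcn0, hcnt, hcn⟩ := exists_map_toLp_eq_smul 𝔸 n
  -- `cm` and `cn` account for passing between the product spaces and their Euclidean versions,
  -- where adjoints make sense.
  refine ⟨cm * c * cn⁻¹, by simp [hcm0, hc0, hcnt], by finiteness, fun R hR g hg => ?_⟩
  let em := WithLp.linearEquiv 2 ℝ (Fin m → 𝔸)
  let en := WithLp.linearEquiv 2 ℝ (Fin n → 𝔸)
  let T : (PiLp 2 fun _ : Fin m => 𝔸) →ₗ[ℝ] (PiLp 2 fun _ : Fin n => 𝔸) :=
    en.symm.toLinearMap ∘ₗ rectMul R ∘ₗ em.toLinearMap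
  let T' : (PiLp 2 fun _ : Fin n => 𝔸) →ₗ[ℝ] (PiLp 2 fun _ : Fin m => 𝔸) :=
    em.symm.toLinearMap ∘ₗ rectMul Rᴴ ∘ₗ en.toLinearMap
  let H : (PiLp 2 fun _ : Fin n => 𝔸) →ₗ[ℝ] (PiLp 2 fun _ : Fin n => 𝔸) :=
    en.symm.toLinearMap ∘ₗ leftInv (R * Rᴴ) ∘ₗ en.toLinearMap
  have hadj : ∀ x y, inner ℝ (T x) y = inner ℝ x (T' y) := fun x y => by
    rw [PiLp.inner_apply, PiLp.inner_apply]
    exact sum_inner_mulVec R (WithLp.ofLp x) (WithLp.ofLp y)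
  have hTT' : T ∘ₗ T' = en.symm.toLinearMap ∘ₗ leftMul (R * Rᴴ) ∘ₗ en.toLinearMap := by
    refine LinearMap.ext fun y => ?_
    exact congrArg (WithLp.toLp 2) (mulVec_conjTranspose_mulVec h R (WithLp.ofLp y))
  have hH : (T ∘ₗ T') ∘ₗ H = LinearMap.id := by
    rw [hTT']
    refine LinearMap.ext fun y => ?_
    exact congrArg (WithLp.toLp 2) (hR.mulVec_leftInv (WithLp.ofLp y))
  have hdT : LinearMap.det (T ∘ₗ T') = hdet (R * Rᴴ) ^ beta 𝔸 := by
    rw [hTT', ← hR.det_leftMul_eq (h.imp_right (by omega))]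
    exact LinearMap.det_conj (leftMul (R * Rᴴ)) en.symm
  have hdet' : LinearMap.det (T ∘ₗ T') ^ (-(1 / 2) : ℝ) = hdet (R * Rᴴ) ^ (-(beta 𝔸 / 2)) := by
    rw [hdT, ← Real.rpow_mul (hR.hdet_pos (h.imp_right (by omega))).le]
    congr 1; ring
  have hpull : ∀ (k : ℕ) (d : ENNReal),
      (volume : Measure (Fin k → 𝔸)).map (WithLp.toLp 2) =
        d • (volume : Measure (PiLp 2 fun _ : Fin k => 𝔸)) →
      ∀ f : (Fin k → 𝔸) → ENNReal, ∫⁻ x, f x = d * ∫⁻ x : PiLp 2 fun _ : Fin k => 𝔸,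
        f (WithLp.ofLp x) := fun k d hd f => by
    rw [← smul_eq_mul, ← lintegral_smul_measure, ← hd]
    exact (lintegral_map_equiv (fun x : PiLp 2 fun _ : Fin k => 𝔸 => f (WithLp.ofLp x))
      (MeasurableEquiv.toLp 2 (Fin k → 𝔸))).symm
  rw [hpull m cm hcm, hpull n cn hcn]
  have key := hc T T' H hadj hH (fun p => g (WithLp.ofLp p.1, p.2))
    (hg.comp ((WithLp.measurable_ofLp 2 _).prodMap measurable_id))
  rw [hdet', hexp] at key
  have hl : ∫⁻ x : PiLp 2 fun _ : Fin m => 𝔸,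
      g (R *ᵥ WithLp.ofLp x, ∑ k, ‖WithLp.ofLp x k‖ ^ 2) =
      ∫⁻ x, g (WithLp.ofLp (T x), ‖x‖ ^ 2) := by
    refine lintegral_congr fun x => ?_
    rw [PiLp.norm_sq_eq_of_L2]
    rfl
  have hr : ∀ y : PiLp 2 fun _ : Fin n => 𝔸, inner ℝ y (H y) =
      invForm (R * Rᴴ) (WithLp.ofLp y) := fun y => PiLp.inner_apply _ _
  simp only [hr] at key
  rw [hl, key]
  have hcc : cn⁻¹ * cn = 1 := ENNReal.inv_mul_cancel hcn0 hcnt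
  set I := ∫⁻ y : PiLp 2 fun _ : Fin n => 𝔸, ∫⁻ t in Set.Ioi (0 : ℝ),
    ENNReal.ofReal (t ^ ((m - n) * beta 𝔸 / 2 - 1)) *
      g (WithLp.ofLp y, t + invForm (R * Rᴴ) (WithLp.ofLp y))
  set D := ENNReal.ofReal (hdet (R * Rᴴ) ^ (-(beta 𝔸 / 2)))
  calc cm * (c * D * I) = cm * c * (cn⁻¹ * cn) * D * I := by rw [hcc]; ring
    _ = _ := by ring

theorem measurable_comp_bordered {n : ℕ} {α β : Type*} [MeasurableSpace α] [MeasurableSpace β]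
    {f : Matrix (Fin (n + 1)) (Fin (n + 1)) 𝔸 → β} (hf : Measurable f) {s : α → ℝ}
    {y : α → Fin n → 𝔸} {B : α → Matrix (Fin n) (Fin n) 𝔸} (hs : Measurable s)
    (hy : Measurable y) (hB : Measurable B) : Measurable fun a => f (bordered (s a) (y a) (B a)) :=
  hf.comp ((continuous_bordered n).measurable.comp (hs.prodMk (hy.prodMk hB)))

theorem measurable_hermOf (n : ℕ) : Measurable
    (hermOf : (Fin n → ℝ) × (Below n → 𝔸) → Matrix (Fin n) (Fin n) 𝔸) := by
  refine Continuous.measurable (continuous_matrix fun i j => ?_)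
  simp only [hermOf, Matrix.of_apply]
  split_ifs <;> fun_prop

instance sFinite_hermVol (n : ℕ) : SFinite (hermVol 𝔸 n) := by
  unfold hermVol; infer_instance

/-- Fubini, after regrouping the coordinates as corner s, first column y and remaining block. -/
theorem lintegral_hermVol_succ {n : ℕ}
    {f : Matrix (Fin (n + 1)) (Fin (n + 1)) 𝔸 → ENNReal} (hf : Measurable f) :
    ∫⁻ B, f B ∂(hermVol 𝔸 (n + 1)) =
      ∫⁻ B, (∫⁻ y : Fin n → 𝔸, ∫⁻ s : ℝ, f (bordered s y B)) ∂(hermVol 𝔸 n) := by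
  let D := Measure.pi fun _ : Fin n => (volume : Measure ℝ)
  let W := Measure.pi fun _ : Below n => (volume : Measure 𝔸)
  have : SFinite D := inferInstanceAs (SFinite (Measure.pi fun _ : Fin n => (volume : Measure ℝ)))
  have : SFinite W := inferInstanceAs (SFinite (Measure.pi fun _ : Below n => (volume : Measure 𝔸)))
  let e₁ := (MeasurableEquiv.piFinSuccAbove (fun _ : Fin (n + 1) => ℝ) 0).symm
  let e₂ := (MeasurableEquiv.sumPiEquivProdPi fun _ : Fin n ⊕ Below n => 𝔸).symm.trans
    (MeasurableEquiv.piCongrLeft (fun _ => 𝔸) (belowSucc n))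
  have h1 : MeasurePreserving e₁ ((volume : Measure ℝ).prod D)
      (Measure.pi fun _ : Fin (n + 1) => (volume : Measure ℝ)) :=
    (measurePreserving_piFinSuccAbove (fun _ : Fin (n + 1) => (volume : Measure ℝ)) 0).symm
  have h2 : MeasurePreserving e₂ ((volume : Measure (Fin n → 𝔸)).prod W)
      (Measure.pi fun _ : Below (n + 1) => (volume : Measure 𝔸)) :=
    (measurePreserving_piCongrLeft (fun _ : Below (n + 1) => (volume : Measure 𝔸))
      (belowSucc n)).comp
      (measurePreserving_sumPiEquivProdPi_symm fun _ : Fin n ⊕ Below n => (volume : Measure 𝔸))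
  have hglue : ∀ p : (ℝ × (Fin n → ℝ)) × ((Fin n → 𝔸) × (Below n → 𝔸)),
      hermOf (Prod.map e₁ e₂ p) = bordered p.1.1 p.2.1 (hermOf (p.1.2, p.2.2)) := by
    rintro ⟨⟨s, d⟩, ⟨y, b⟩⟩
    have he : e₁ (s, d) = Fin.cons s d := Fin.insertNth_zero' s d
    change hermOf (e₁ (s, d), e₂ (y, b)) = _
    rw [he]
    refine hermOf_cons n s d y b _ (fun i => ?_) fun p => ?_
    · exact MeasurableEquiv.piCongrLeft_apply_apply (β := fun _ => 𝔸) (belowSucc n)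
        ((MeasurableEquiv.sumPiEquivProdPi fun _ : Fin n ⊕ Below n => 𝔸).symm (y, b)) (Sum.inl i)
    · exact MeasurableEquiv.piCongrLeft_apply_apply (β := fun _ => 𝔸) (belowSucc n)
        ((MeasurableEquiv.sumPiEquivProdPi fun _ : Fin n ⊕ Below n => 𝔸).symm (y, b)) (Sum.inr p)
  have hB : Measurable fun p : (Fin n → ℝ) × (Below n → 𝔸) =>
      ∫⁻ y : Fin n → 𝔸, ∫⁻ s : ℝ, f (bordered s y (hermOf p)) := by
    refine Measurable.lintegral_prod_right' (f := fun q : ((Fin n → ℝ) × (Below n → 𝔸)) ×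
      (Fin n → 𝔸) => ∫⁻ s : ℝ, f (bordered s q.2 (hermOf q.1))) ?_
    refine Measurable.lintegral_prod_right' (f := fun q : (((Fin n → ℝ) × (Below n → 𝔸)) ×
      (Fin n → 𝔸)) × ℝ => f (bordered q.2 q.1.2 (hermOf q.1.1))) ?_
    exact measurable_comp_bordered hf measurable_snd measurable_fst.snd
      ((measurable_hermOf n).comp measurable_fst.fst)
  have hF : Measurable fun p : (ℝ × (Fin n → ℝ)) × ((Fin n → 𝔸) × (Below n → 𝔸)) =>
      f (bordered p.1.1 p.2.1 (hermOf (p.1.2, p.2.2))) :=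
    measurable_comp_bordered hf measurable_fst.fst measurable_snd.fst
      ((measurable_hermOf n).comp (measurable_fst.snd.prodMk measurable_snd.snd))
  have h12 := h1.prod h2
  rw [hermVol, lintegral_map hf (measurable_hermOf _),
    ← h12.lintegral_comp (f := fun x => f (hermOf x)) (hf.comp (measurable_hermOf _))]
  simp only [hglue]
  have hr : ∫⁻ B, (∫⁻ y : Fin n → 𝔸, ∫⁻ s : ℝ, f (bordered s y B)) ∂(hermVol 𝔸 n) =
      ∫⁻ p, (∫⁻ y : Fin n → 𝔸, ∫⁻ s : ℝ, f (bordered s y (hermOf p))) ∂(D.prod W) := by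
    rw [hermVol, lintegral_map _ (measurable_hermOf _)]
    refine Measurable.lintegral_prod_right' (f := fun q : Matrix (Fin n) (Fin n) 𝔸 ×
      (Fin n → 𝔸) => ∫⁻ s : ℝ, f (bordered s q.2 q.1)) ?_
    refine Measurable.lintegral_prod_right' (f := fun q : (Matrix (Fin n) (Fin n) 𝔸 ×
      (Fin n → 𝔸)) × ℝ => f (bordered q.2 q.1.2 q.1.1)) ?_
    exact measurable_comp_bordered hf measurable_snd measurable_fst.snd measurable_fst.fst
  rw [hr, lintegral_prod _ hF.aemeasurable,
    lintegral_prod_symm _ hF.lintegral_prod_right'.aemeasurable,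
    lintegral_prod _ hB.aemeasurable]
  refine lintegral_congr fun d => ?_
  have hd : Measurable fun p : ℝ × ((Fin n → 𝔸) × (Below n → 𝔸)) =>
      f (bordered p.1 p.2.1 (hermOf (d, p.2.2))) :=
    hF.comp ((measurable_fst.prodMk measurable_const).prodMk measurable_snd)
  have hd' : Measurable fun q : (Fin n → 𝔸) × (Below n → 𝔸) =>
      ∫⁻ s : ℝ, f (bordered s q.1 (hermOf (d, q.2))) := hd.lintegral_prod_left'
  rw [lintegral_lintegral_swap (f := fun s (q : (Fin n → 𝔸) × (Below n → 𝔸)) =>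
    f (bordered s q.1 (hermOf (d, q.2)))) hd.aemeasurable]
  exact lintegral_prod_symm _ hd'.aemeasurable

end BetaRiesz

/-! ### The law of R R* up to a constant -/

namespace BetaRiesz

open RealNormedDivisionAlgebra Module

/-- The corner is also written with the conjugated row, so that everything depends on x = r̄. -/
theorem cons_mul_conjTranspose {𝔸 : Type*} [RealNormedDivisionAlgebra 𝔸] {n m : ℕ}
    (r : Fin m → 𝔸) (R : Matrix (Fin n) (Fin m) 𝔸) :
    (Matrix.of (Fin.cons r R : Fin (n + 1) → Fin m → 𝔸)) *
        (Matrix.of (Fin.cons r R : Fin (n + 1) → Fin m → 𝔸))ᴴ =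
      bordered (∑ k, ‖star (r k)‖ ^ 2) (R *ᵥ fun k => star (r k)) (R * Rᴴ) := by
  have hH := isHermitian_mul_conjTranspose (Matrix.of (Fin.cons r R : Fin (n + 1) → Fin m → 𝔸))
  have h1 : ∀ i : Fin n, ((Matrix.of (Fin.cons r R : Fin (n + 1) → Fin m → 𝔸)) *
        (Matrix.of (Fin.cons r R : Fin (n + 1) → Fin m → 𝔸))ᴴ) i.succ 0 =
        (R *ᵥ fun k => star (r k)) i := fun i => rfl
  ext i j
  cases i using Fin.cases with
  | zero =>
    cases j using Fin.cases with
    | zero =>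
      simp only [Matrix.mul_apply, conjTranspose_apply, Matrix.of_apply, bordered_zero_zero,
        norm_star_eq, mul_star_self_eq, Finset.sum_smul]
      rfl
    | succ j => rw [← hH.apply, h1, bordered_zero_succ]
  | succ i => cases j using Fin.cases <;> rfl

variable {𝔸 : Type*} [RealNormedDivisionAlgebra 𝔸]

/-- The Wishart weight: `|B| ^ ((m - n + 1) β / 2 - 1)` on positive definite matrices. -/
noncomputable def weight {n : ℕ} (m : ℕ) (B : Matrix (Fin n) (Fin n) 𝔸) : ENNReal :=
  Set.indicator {B | PosDef B}
    (fun B => ENNReal.ofReal (hdet B ^ (((m : ℝ) - n + 1) * beta 𝔸 / 2 - 1))) B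

theorem weight_of_posDef {n : ℕ} (m : ℕ) {B : Matrix (Fin n) (Fin n) 𝔸} (hB : PosDef B) :
    weight m B = ENNReal.ofReal (hdet B ^ (((m : ℝ) - n + 1) * beta 𝔸 / 2 - 1)) :=
  Set.indicator_of_mem (s := {B | PosDef B}) hB _

theorem weight_of_not_posDef {n : ℕ} (m : ℕ) {B : Matrix (Fin n) (Fin n) 𝔸} (hB : ¬PosDef B) :
    weight m B = 0 :=
  Set.indicator_of_notMem (s := {B | PosDef B}) hB _

variable [MeasurableSpace 𝔸] [BorelSpace 𝔸]

instance sigmaFinite_matVol (n m : ℕ) : SigmaFinite (matVol 𝔸 n m) :=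
  Measure.pi.sigmaFinite fun _ : Fin n => (volume : Measure (Fin m → 𝔸))

theorem lintegral_matVol_succ {n m : ℕ}
    {f : Matrix (Fin (n + 1)) (Fin (n + 1)) 𝔸 → ENNReal} (hf : Measurable f) :
    ∫⁻ R, f (R * Rᴴ) ∂(matVol 𝔸 (n + 1) m) =
      ∫⁻ R, (∫⁻ x : Fin m → 𝔸, f (bordered (∑ k, ‖x k‖ ^ 2) (R *ᵥ x) (R * Rᴴ)))
        ∂(matVol 𝔸 n m) := by
  have h1 : MeasurePreserving
      (MeasurableEquiv.piFinSuccAbove (fun _ : Fin (n + 1) => Fin m → 𝔸) 0).symm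
      ((volume : Measure (Fin m → 𝔸)).prod (matVol 𝔸 n m)) (matVol 𝔸 (n + 1) m) :=
    (measurePreserving_piFinSuccAbove
      (fun _ : Fin (n + 1) => (volume : Measure (Fin m → 𝔸))) 0).symm
  have hm : Measurable fun R : Matrix (Fin (n + 1)) (Fin m) 𝔸 => f (R * Rᴴ) :=
    hf.comp (measurable_mul_conjTranspose _ _)
  refine (h1.lintegral_comp hm).symm.trans
    ((lintegral_prod_symm' (μ := (volume : Measure (Fin m → 𝔸))) (ν := matVol 𝔸 n m) _
      (hm.comp h1.measurable)).trans ?_)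
  refine lintegral_congr fun R => ?_
  -- Conjugation is an isometry, so r may be replaced by x = r̄.
  have h2 : MeasurePreserving (fun (x : Fin m → 𝔸) k => star (x k)) :=
    volume_preserving_pi fun _ => starIsometry.measurePreserving
  have hc : Measurable fun x : Fin m → 𝔸 =>
      f (bordered (∑ k, ‖x k‖ ^ 2) (R *ᵥ x) (R * Rᴴ)) :=
    measurable_comp_bordered hf (by fun_prop)
      (continuous_const.matrix_mulVec continuous_id).measurable measurable_const
  rw [← h2.lintegral_comp hc]
  refine lintegral_congr fun r => ?_
  rw [← cons_mul_conjTranspose]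
  have he : (MeasurableEquiv.piFinSuccAbove (fun _ : Fin (n + 1) => Fin m → 𝔸) 0).symm (r, R) =
    Matrix.of (Fin.cons r R : Fin (n + 1) → Fin m → 𝔸) := Fin.insertNth_zero' r R
  exact congrArg (fun Q : Matrix (Fin (n + 1)) (Fin m) 𝔸 => f (Q * Qᴴ)) he

theorem measurable_weight (n m : ℕ) :
    Measurable (weight m : Matrix (Fin n) (Fin n) 𝔸 → ENNReal) :=
  ((measurable_hdet n).pow_const _).ennreal_ofReal.indicator (measurableSet_posDef n)

/-- Translate s by y*B⁻¹y: the new variable t is the Schur complement, the cone becomes t > 0, and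
the weight splits into equal powers of |B| and t. -/
theorem lintegral_bordered_weight {n : ℕ} (m : ℕ)
    (h : (∀ x y z : 𝔸, (x * y) * z = x * (y * z)) ∨ n ≤ 1)
    {B : Matrix (Fin n) (Fin n) 𝔸} (hB : PosDef B) (y : Fin n → 𝔸)
    {f : Matrix (Fin (n + 1)) (Fin (n + 1)) 𝔸 → ENNReal} (hf : Measurable f) :
    ∫⁻ s : ℝ, weight m (bordered s y B) * f (bordered s y B) =
      ENNReal.ofReal (hdet B ^ (((m : ℝ) - n) * beta 𝔸 / 2 - 1)) *
        ∫⁻ t in Set.Ioi (0 : ℝ), ENNReal.ofReal (t ^ (((m : ℝ) - n) * beta 𝔸 / 2 - 1)) *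
          f (bordered (t + invForm B y) y B) := by
  have hm : Measurable fun t : ℝ => f (bordered (t + invForm B y) y B) :=
    measurable_comp_bordered hf (by fun_prop) measurable_const measurable_const
  have hp : Measurable fun t : ℝ =>
      ENNReal.ofReal (t ^ (((m : ℝ) - n) * beta 𝔸 / 2 - 1)) := by fun_prop
  rw [← lintegral_add_right_eq_self
      (fun s : ℝ => weight m (bordered s y B) * f (bordered s y B)) (invForm B y),
    ← lintegral_const_mul _ (f := fun t : ℝ =>
      ENNReal.ofReal (t ^ (((m : ℝ) - n) * beta 𝔸 / 2 - 1)) *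
        f (bordered (t + invForm B y) y B)) (hp.mul hm),
    ← lintegral_indicator measurableSet_Ioi]
  refine lintegral_congr fun t => ?_
  by_cases ht : 0 < t
  · have hP : PosDef (bordered (t + invForm B y) y B) :=
      (posDef_bordered_iff h).2 ⟨hB, by simpa using ht⟩
    rw [weight_of_posDef m hP, Set.indicator_of_mem (Set.mem_Ioi.2 ht),
      hdet_bordered h hB (by simpa using ht.le), add_sub_cancel_right,
      Real.mul_rpow (hB.hdet_pos (h.imp_right (by omega))).le ht.le,
      ENNReal.ofReal_mul (Real.rpow_nonneg (hB.hdet_pos (h.imp_right (by omega))).le _), mul_assoc]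
    push_cast
    rw [show (m : ℝ) - (n + 1) + 1 = m - n by ring]
  · have hP : ¬PosDef (bordered (t + invForm B y) y B) := fun hP =>
      ht (by simpa using ((posDef_bordered_iff h).1 hP).2)
    rw [weight_of_not_posDef m hP, Set.indicator_of_notMem (by simpa using ht), zero_mul]

/-- Test the formula on the indicator of the complement of the cone, where the weight vanishes. -/
theorem ae_posDef_of_lintegral {n m : ℕ} {C : ENNReal}
    (h : ∀ f : Matrix (Fin n) (Fin n) 𝔸 → ENNReal, Measurable f →
      ∫⁻ R, f (R * Rᴴ) ∂(matVol 𝔸 n m) = C * ∫⁻ B, weight m B * f B ∂(hermVol 𝔸 n)) :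
    ∀ᵐ R ∂(matVol 𝔸 n m), PosDef (R * Rᴴ) := by
  have hs := (measurableSet_posDef (𝔸 := 𝔸) n).compl
  have h1 := h (Set.indicator {B | PosDef B}ᶜ 1) (measurable_one.indicator hs)
  have h2 : ∀ B : Matrix (Fin n) (Fin n) 𝔸,
      weight m B * Set.indicator {B | PosDef B}ᶜ 1 B = 0 := fun B => by
    by_cases hB : PosDef B
    · rw [Set.indicator_of_notMem (by simpa using hB), mul_zero]
    · rw [weight_of_not_posDef m hB, zero_mul]
  simp only [h2, lintegral_zero, mul_zero] at h1
  have hm : Measurable fun R : Matrix (Fin n) (Fin m) 𝔸 =>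
      Set.indicator {B | PosDef B}ᶜ (1 : Matrix (Fin n) (Fin n) 𝔸 → ENNReal) (R * Rᴴ) :=
    (measurable_one.indicator hs).comp (measurable_mul_conjTranspose n m)
  rw [lintegral_eq_zero_iff hm] at h1
  filter_upwards [h1] with R hR
  by_contra hP
  simp [hP] at hR

/-- Up to a constant, `B = R R*` has the Wishart weight as its density if `R` is distributed
according to Lebesgue measure. -/
theorem exists_lintegral_mul_conjTranspose (n m : ℕ) (hnm : n ≤ m)
    (h : (∀ x y z : 𝔸, (x * y) * z = x * (y * z)) ∨ n ≤ 2) :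
    ∃ C : ENNReal, C ≠ 0 ∧ C ≠ ⊤ ∧ ∀ f : Matrix (Fin n) (Fin n) 𝔸 → ENNReal, Measurable f →
      ∫⁻ R, f (R * Rᴴ) ∂(matVol 𝔸 n m) = C * ∫⁻ B, weight m B * f B ∂(hermVol 𝔸 n) := by
  induction n with
  | zero =>
    refine ⟨1, one_ne_zero, ENNReal.one_ne_top, fun f _ => ?_⟩
    have hP : ∀ B : Matrix (Fin 0) (Fin 0) 𝔸, PosDef B := fun B =>
      ⟨Subsingleton.elim _ _, fun v hv => absurd (Subsingleton.elim v 0) hv⟩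
    have hw : ∀ B : Matrix (Fin 0) (Fin 0) 𝔸, weight m B * f B = f 0 := fun B => by
      rw [weight_of_posDef m (hP B), hdet, LinearMap.det_eq_one_of_subsingleton, Real.one_rpow,
        Real.one_rpow, ENNReal.ofReal_one, one_mul, Subsingleton.elim B 0]
    have hf : ∀ R : Matrix (Fin 0) (Fin m) 𝔸, f (R * Rᴴ) = f 0 := fun R => by
      rw [Subsingleton.elim (R * Rᴴ) 0]
    simp only [hw, hf, lintegral_const, one_mul]
    congr 1
    have h1 : matVol 𝔸 0 m Set.univ = 1 :=
      (Measure.pi_univ fun _ : Fin 0 => (volume : Measure (Fin m → 𝔸))).trans (by simp)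
    rw [hermVol, Measure.map_apply (measurable_hermOf 0) MeasurableSet.univ, h1]
    simp [← Set.univ_prod_univ, Measure.prod_prod]
  | succ n ih =>
    have h' : (∀ x y z : 𝔸, (x * y) * z = x * (y * z)) ∨ n ≤ 1 := h.imp_right (by omega)
    obtain ⟨C, hC0, hCt, hC⟩ := ih (by omega) (h.imp_right (by omega))
    -- From n + 1 ≤ m comes n < m, so the kernel of R has positive dimension and polar coordinates
    -- apply there.
    obtain ⟨c, hc0, hct, hc⟩ := lintegral_mulVec_norm_sq 𝔸 (Nat.lt_of_succ_le hnm) h'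
    refine ⟨C * c, mul_ne_zero hC0 hc0, ENNReal.mul_ne_top hCt hct, fun f hf => ?_⟩
    set p : ℝ := ((m : ℝ) - n) * beta 𝔸 / 2 - 1 with hp
    let J : Matrix (Fin n) (Fin n) 𝔸 → ENNReal := fun B =>
      ∫⁻ y : Fin n → 𝔸, ∫⁻ s : ℝ, weight m (bordered s y B) * f (bordered s y B)
    have hJ : Measurable J := by
      refine Measurable.lintegral_prod_right' (f := fun q : Matrix (Fin n) (Fin n) 𝔸 ×
        (Fin n → 𝔸) => ∫⁻ s : ℝ, weight m (bordered s q.2 q.1) * f (bordered s q.2 q.1)) ?_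
      refine Measurable.lintegral_prod_right' (f := fun q : (Matrix (Fin n) (Fin n) 𝔸 ×
        (Fin n → 𝔸)) × ℝ => weight m (bordered q.2 q.1.2 q.1.1) * f (bordered q.2 q.1.2 q.1.1)) ?_
      exact measurable_comp_bordered ((measurable_weight (n + 1) m).mul hf) measurable_snd
        measurable_fst.snd measurable_fst.fst
    -- `J` carries |B|^p, while integrating out the new row gives |B|^(-β/2); the exponent here
    -- converts one into the other. It is also minus the exponent of the size-n weight, so after the
    -- induction hypothesis only c · J is left.
    let F : Matrix (Fin n) (Fin n) 𝔸 → ENNReal := fun B =>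
      c * ENNReal.ofReal (hdet B ^ (-(beta 𝔸 / 2) - p)) * J B
    have hF : Measurable F :=
      (((measurable_hdet n).pow_const _).ennreal_ofReal.const_mul c).mul hJ
    have hJeq : ∀ B : Matrix (Fin n) (Fin n) 𝔸, PosDef B → J B = ENNReal.ofReal (hdet B ^ p) *
        ∫⁻ y : Fin n → 𝔸, ∫⁻ t in Set.Ioi (0 : ℝ), ENNReal.ofReal (t ^ p) *
          f (bordered (t + invForm B y) y B) := fun B hB => by
      have hm : Measurable fun y : Fin n → 𝔸 => ∫⁻ t in Set.Ioi (0 : ℝ),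
          ENNReal.ofReal (t ^ p) * f (bordered (t + invForm B y) y B) := by
        refine Measurable.lintegral_prod_right' (f := fun q : (Fin n → 𝔸) × ℝ =>
          ENNReal.ofReal (q.2 ^ p) * f (bordered (q.2 + invForm B q.1) q.1 B)) ?_
        have hL : Continuous (leftInv B) := (leftInv B).continuous_of_finiteDimensional
        have hi : Continuous (invForm B) := continuous_finsetSum _ fun i _ =>
          (continuous_apply i).inner ((continuous_apply i).comp hL)
        exact Measurable.mul (by fun_prop) (measurable_comp_bordered hf
          (measurable_snd.add (hi.measurable.comp measurable_fst)) measurable_fst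
          measurable_const)
      rw [← lintegral_const_mul _ hm]
      exact lintegral_congr fun y => lintegral_bordered_weight m h' hB y hf
    rw [lintegral_matVol_succ hf]
    calc ∫⁻ R, (∫⁻ x : Fin m → 𝔸, f (bordered (∑ k, ‖x k‖ ^ 2) (R *ᵥ x) (R * Rᴴ)))
          ∂(matVol 𝔸 n m)
        = ∫⁻ R, F (R * Rᴴ) ∂(matVol 𝔸 n m) := by
          refine lintegral_congr_ae ?_
          filter_upwards [ae_posDef_of_lintegral hC] with R hR
          have hg : Measurable fun q : (Fin n → 𝔸) × ℝ => f (bordered q.2 q.1 (R * Rᴴ)) :=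
            measurable_comp_bordered hf measurable_snd measurable_fst measurable_const
          have hd := hR.hdet_pos (h'.imp_right (by omega))
          rw [hc R hR _ hg]
          simp only [F]
          rw [hJeq _ hR, ← mul_assoc, mul_assoc c (ENNReal.ofReal _) (ENNReal.ofReal _),
            ← ENNReal.ofReal_mul (Real.rpow_nonneg hd.le _), ← Real.rpow_add hd, sub_add_cancel]
      _ = C * ∫⁻ B, weight m B * F B ∂(hermVol 𝔸 n) := hC F hF
      _ = C * ∫⁻ B, c * J B ∂(hermVol 𝔸 n) := by
          congr 1
          refine lintegral_congr fun B => ?_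
          by_cases hB : PosDef B
          · have hd := hB.hdet_pos (h'.imp_right (by omega))
            simp only [F]
            rw [weight_of_posDef m hB, mul_comm c, ← mul_assoc, ← mul_assoc,
              ← ENNReal.ofReal_mul (Real.rpow_nonneg hd.le _), ← Real.rpow_add hd,
              show ((m : ℝ) - n + 1) * beta 𝔸 / 2 - 1 + (-(beta 𝔸 / 2) - p) = 0 by
                rw [hp]; ring, Real.rpow_zero, ENNReal.ofReal_one, one_mul]
          · have hz : J B = 0 := by
              have : ∀ (y : Fin n → 𝔸) (s : ℝ), weight m (bordered s y B) = 0 := fun y s =>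
                weight_of_not_posDef m fun hP => hB ((posDef_bordered_iff h').1 hP).1
              simp [J, this]
            simp [F, hz]
      _ = _ := by
          rw [lintegral_const_mul _ hJ, ← mul_assoc]
          exact congrArg _ (lintegral_hermVol_succ ((measurable_weight (n + 1) m).mul hf)).symm

end BetaRiesz

/-! ### The normalising constant and the transfer of densities -/

namespace BetaRiesz

open RealNormedDivisionAlgebra Module

theorem rtrace_mul_conjTranspose {𝔸 : Type*} [RealNormedDivisionAlgebra 𝔸] {n m : ℕ}
    (R : Matrix (Fin n) (Fin m) 𝔸) : rtrace (R * Rᴴ) = ∑ i, ∑ k, ‖R i k‖ ^ 2 := by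
  simp only [rtrace, Matrix.mul_apply, conjTranspose_apply, mul_star_self_eq, sum_inner,
    inner_smul_one_one]

variable {𝔸 : Type*} [RealNormedDivisionAlgebra 𝔸] [MeasurableSpace 𝔸] [BorelSpace 𝔸]

theorem measurable_rtrace (n : ℕ) : Measurable (rtrace : Matrix (Fin n) (Fin n) 𝔸 → ℝ) := by
  refine (continuous_finsetSum _ fun i _ => ?_).measurable
  exact (continuous_id.matrix_elem i i).inner continuous_const

theorem integral_exp_neg_rtrace (n m : ℕ) :
    ∫ R, Real.exp (-rtrace (R * Rᴴ)) ∂(matVol 𝔸 n m) = Real.pi ^ (m * n * beta 𝔸 / 2) := by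
  have h1 : ∀ R : Matrix (Fin n) (Fin m) 𝔸, Real.exp (-rtrace (R * Rᴴ)) =
      ∏ i, ∏ k, Real.exp (-1 * ‖R i k‖ ^ 2) := fun R => by
    simp only [rtrace_mul_conjTranspose, ← Real.exp_sum, neg_one_mul, Finset.sum_neg_distrib]
  have h2 : ∫ x : Fin m → 𝔸, ∏ k, Real.exp (-1 * ‖x k‖ ^ 2) =
      (Real.pi ^ (beta 𝔸 / 2)) ^ m := by
    rw [integral_fintype_prod_volume_eq_pow fun x : 𝔸 => Real.exp (-1 * ‖x‖ ^ 2),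
      GaussianFourier.integral_rexp_neg_mul_sq_norm one_pos, div_one, Fintype.card_fin, beta]
  simp only [h1]
  refine (integral_fintype_prod_volume_eq_pow (ι := Fin n)
    fun x : Fin m → 𝔸 => ∏ k, Real.exp (-1 * ‖x k‖ ^ 2)).trans ?_
  rw [h2, Fintype.card_fin, ← Real.rpow_natCast, ← Real.rpow_natCast,
    ← Real.rpow_mul Real.pi_pos.le, ← Real.rpow_mul Real.pi_pos.le]
  congr 1; ring

theorem lintegral_exp_neg_rtrace (n m : ℕ) :
    ∫⁻ R, ENNReal.ofReal (Real.exp (-rtrace (R * Rᴴ))) ∂(matVol 𝔸 n m) =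
      ENNReal.ofReal (Real.pi ^ (m * n * beta 𝔸 / 2)) := by
  have h := integral_exp_neg_rtrace (𝔸 := 𝔸) n m
  rw [← h, ofReal_integral_eq_lintegral_ofReal _ (Filter.Eventually.of_forall fun R =>
    (Real.exp_pos _).le)]
  -- Without integrability the Bochner integral would be 0, not a power of π.
  by_contra hi
  rw [integral_undef hi] at h
  exact (Real.rpow_pos_of_pos Real.pi_pos _).ne h

theorem multiGamma_eq_toReal {n m : ℕ}
    (h : (∀ x y z : 𝔸, (x * y) * z = x * (y * z)) ∨ n ≤ 2) :
    multiGamma 𝔸 n (m * beta 𝔸 / 2) =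
      (∫⁻ B, weight m B * ENNReal.ofReal (Real.exp (-rtrace B)) ∂(hermVol 𝔸 n)).toReal := by
  have he : (m : ℝ) * beta 𝔸 / 2 - (n - 1) * beta 𝔸 / 2 - 1 =
      ((m : ℝ) - n + 1) * beta 𝔸 / 2 - 1 := by ring
  rw [multiGamma, he, integral_eq_lintegral_of_nonneg_ae]
  · rw [← lintegral_indicator (measurableSet_posDef n)]
    congr 1
    refine lintegral_congr fun B => ?_
    by_cases hB : PosDef B
    · rw [weight_of_posDef m hB, Set.indicator_of_mem (s := {B | PosDef B}) hB,
        mul_comm, ENNReal.ofReal_mul (Real.rpow_nonneg (hB.hdet_pos h).le _)]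
    · rw [weight_of_not_posDef m hB, Set.indicator_of_notMem (s := {B | PosDef B}) hB, zero_mul]
  · filter_upwards [ae_restrict_mem (measurableSet_posDef n)] with B hB
    exact mul_nonneg (Real.exp_pos _).le (Real.rpow_nonneg (PosDef.hdet_pos h hB).le _)
  · exact ((measurable_rtrace n).neg.exp.mul
      ((measurable_hdet n).pow_const _)).aestronglyMeasurable

/-- The distribution of `R R*` under Lebesgue measure, with its normalising constant. -/
theorem lintegral_mul_conjTranspose {n m : ℕ} (hnm : n ≤ m)
    (h : (∀ x y z : 𝔸, (x * y) * z = x * (y * z)) ∨ n ≤ 2)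
    {f : Matrix (Fin n) (Fin n) 𝔸 → ENNReal} (hf : Measurable f) :
    ENNReal.ofReal (multiGamma 𝔸 n (m * beta 𝔸 / 2) / Real.pi ^ (m * n * beta 𝔸 / 2)) *
        ∫⁻ R, f (R * Rᴴ) ∂(matVol 𝔸 n m) =
      ∫⁻ B, weight m B * f B ∂(hermVol 𝔸 n) := by
  obtain ⟨C, hC0, hCt, hC⟩ := exists_lintegral_mul_conjTranspose (𝔸 := 𝔸) n m hnm h
  have hpi : 0 < Real.pi ^ (m * n * beta 𝔸 / 2) := Real.rpow_pos_of_pos Real.pi_pos _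
  -- This test function identifies C: the left side becomes the Gaussian integral, the right side C
  -- · Γ_n[mβ/2].
  have h1 := hC (fun B => ENNReal.ofReal (Real.exp (-rtrace B)))
    (measurable_rtrace n).neg.exp.ennreal_ofReal
  rw [lintegral_exp_neg_rtrace] at h1
  set L := ∫⁻ B, weight m B * ENNReal.ofReal (Real.exp (-rtrace B)) ∂(hermVol 𝔸 n) with hL
  have hLt : L ≠ ⊤ := fun hLt => by
    rw [hLt, ENNReal.mul_top hC0] at h1
    exact ENNReal.ofReal_ne_top h1
  have h2 : ENNReal.ofReal (multiGamma 𝔸 n (m * beta 𝔸 / 2) /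
      Real.pi ^ (m * n * beta 𝔸 / 2)) * C = 1 := by
    rw [ENNReal.ofReal_div_of_pos hpi, multiGamma_eq_toReal h, ENNReal.ofReal_toReal hLt, h1,
      mul_comm, ← mul_div_assoc]
    refine ENNReal.div_self (fun h0 => ?_) (ENNReal.mul_ne_top hCt hLt)
    rw [h0] at h1
    exact (ENNReal.ofReal_pos.2 hpi).ne' h1
  rw [hC f hf, ← mul_assoc, h2, one_mul]

theorem ae_posDef_mul_conjTranspose {n m : ℕ} (hnm : n ≤ m)
    (h : (∀ x y z : 𝔸, (x * y) * z = x * (y * z)) ∨ n ≤ 2) :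
    ∀ᵐ R ∂(matVol 𝔸 n m), PosDef (R * Rᴴ) := by
  obtain ⟨C, -, -, hC⟩ := exists_lintegral_mul_conjTranspose (𝔸 := 𝔸) n m hnm h
  exact ae_posDef_of_lintegral hC

theorem measurableSet_posDef_and_posDef_one_sub (n : ℕ) :
    MeasurableSet {B : Matrix (Fin n) (Fin n) 𝔸 | PosDef B ∧ PosDef (1 - B)} :=
  (measurableSet_posDef n).inter
    ((continuous_const.sub continuous_id).measurable (measurableSet_posDef n))

open Classical in
/-- If the density of `R` is a function of `R R*`, supported where `0 < R R* < 1`, then the density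
of `R R*` is the same function times the Wishart weight. -/
theorem HasDensity.mul_conjTranspose {n m : ℕ} (hnm : n ≤ m)
    (h : (∀ x y z : 𝔸, (x * y) * z = x * (y * z)) ∨ n ≤ 2)
    {Ω : Type*} [MeasurableSpace Ω] {P : Measure Ω} {X : Ω → Matrix (Fin n) (Fin m) 𝔸}
    {fR : Matrix (Fin n) (Fin m) 𝔸 → ℝ} {fB w : Matrix (Fin n) (Fin n) 𝔸 → ℝ}
    (hw : Measurable w)
    (hfR : ∀ R, fR R = if PosDef (R * Rᴴ) ∧ PosDef (1 - R * Rᴴ) then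
      multiGamma 𝔸 n (m * beta 𝔸 / 2) / Real.pi ^ (m * n * beta 𝔸 / 2) * w (R * Rᴴ) else 0)
    (hfB : ∀ B, fB B = if PosDef B ∧ PosDef (1 - B) then
      hdet B ^ (((m : ℝ) - n + 1) * beta 𝔸 / 2 - 1) * w B else 0)
    (hX : HasDensity P X (matVol 𝔸 n m) fR) :
    (∀ᵐ ω ∂P, PosDef (X ω * (X ω)ᴴ)) ∧
      HasDensity P (fun ω => X ω * (X ω)ᴴ) (hermVol 𝔸 n) fB := by
  obtain ⟨hXm, hXd⟩ := hX
  have hφ := measurable_mul_conjTranspose (𝔸 := 𝔸) n m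
  refine ⟨ae_of_ae_map (p := fun R => PosDef (R * Rᴴ)) hXm ?_, hφ.comp_aemeasurable hXm, ?_⟩
  · rw [hXd]
    exact (withDensity_absolutelyContinuous _ _).ae_le (ae_posDef_mul_conjTranspose hnm h)
  let u : Matrix (Fin n) (Fin n) 𝔸 → ENNReal :=
    Set.indicator {B | PosDef B ∧ PosDef (1 - B)} fun B => ENNReal.ofReal (w B)
  have hu : Measurable u :=
    hw.ennreal_ofReal.indicator (measurableSet_posDef_and_posDef_one_sub n)
  -- Nothing is assumed about the sign of `w`, so `ENNReal.ofReal` splits over the product only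
  -- because this factor is nonnegative.
  have hmG : 0 ≤ multiGamma 𝔸 n (m * beta 𝔸 / 2) / Real.pi ^ (m * n * beta 𝔸 / 2) := by
    rw [multiGamma_eq_toReal h]
    exact div_nonneg ENNReal.toReal_nonneg (Real.rpow_nonneg Real.pi_pos.le _)
  have hR : ∀ R, ENNReal.ofReal (fR R) = ENNReal.ofReal (multiGamma 𝔸 n (m * beta 𝔸 / 2) /
      Real.pi ^ (m * n * beta 𝔸 / 2)) * u (R * Rᴴ) := fun R => by
    rw [hfR]
    by_cases hP : PosDef (R * Rᴴ) ∧ PosDef (1 - R * Rᴴ)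
    · rw [if_pos hP, ENNReal.ofReal_mul hmG]
      simp only [u]
      rw [Set.indicator_of_mem (s := {B | PosDef B ∧ PosDef (1 - B)}) hP]
    · rw [if_neg hP]
      simp only [u]
      rw [Set.indicator_of_notMem (s := {B | PosDef B ∧ PosDef (1 - B)}) hP]
      simp
  have hB : ∀ B, ENNReal.ofReal (fB B) = weight m B * u B := fun B => by
    rw [hfB]
    by_cases hP : PosDef B ∧ PosDef (1 - B)
    · rw [if_pos hP, ENNReal.ofReal_mul (Real.rpow_nonneg (hP.1.hdet_pos h).le _),
        weight_of_posDef m hP.1]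
      simp only [u]
      rw [Set.indicator_of_mem (s := {B | PosDef B ∧ PosDef (1 - B)}) hP]
    · rw [if_neg hP]
      simp only [u]
      rw [Set.indicator_of_notMem (s := {B | PosDef B ∧ PosDef (1 - B)}) hP]
      simp
  have hmap := AEMeasurable.map_map_of_aemeasurable hφ.aemeasurable hXm
  simp only [Function.comp_def] at hmap
  rw [← hmap, hXd]
  refine Measure.ext fun s hs => ?_
  have hmu : Measurable fun R : Matrix (Fin n) (Fin m) 𝔸 => s.indicator u (R * Rᴴ) :=
    (hu.indicator hs).comp hφ
  rw [Measure.map_apply hφ hs, withDensity_apply _ (hφ hs), withDensity_apply _ hs,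
    ← lintegral_indicator (hφ hs), ← lintegral_indicator hs]
  have h1 : ∀ R : Matrix (Fin n) (Fin m) 𝔸,
      ((fun R : Matrix (Fin n) (Fin m) 𝔸 => R * Rᴴ) ⁻¹' s).indicator
        (fun R => ENNReal.ofReal (fR R)) R = ENNReal.ofReal (multiGamma 𝔸 n (m * beta 𝔸 / 2) /
          Real.pi ^ (m * n * beta 𝔸 / 2)) * s.indicator u (R * Rᴴ) := fun R => by
    by_cases hs : R * Rᴴ ∈ s
    · rw [Set.indicator_of_mem (by exact hs), Set.indicator_of_mem hs, hR]
    · rw [Set.indicator_of_notMem (by exact hs), Set.indicator_of_notMem hs, mul_zero]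
  have h2 : ∀ B, s.indicator (fun B => ENNReal.ofReal (fB B)) B =
      weight m B * s.indicator u B := fun B => by
    by_cases hs : B ∈ s
    · rw [Set.indicator_of_mem hs, Set.indicator_of_mem hs, hB]
    · rw [Set.indicator_of_notMem hs, Set.indicator_of_notMem hs, mul_zero]
  simp only [h1, h2]
  rw [lintegral_const_mul _ hmu, lintegral_mul_conjTranspose hnm h (hu.indicator hs)]

end BetaRiesz

theorem theorem3p3 {𝔸 : Type*} [RealNormedDivisionAlgebra 𝔸] [MeasurableSpace 𝔸] [BorelSpace 𝔸]
    {n m : ℕ} (hn : 0 < n) (hnm : n < m)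
    (h𝔸 : (∀ x y z : 𝔸, (x * y) * z = x * (y * z)) ∨ n ≤ 2)
    {Ω : Type*} [MeasurableSpace Ω] (P : Measure Ω) [IsProbabilityMeasure P]
    (a : ℝ) (κ₁ τ₁ : Fin n → ℝ) (R₁ : Ω → Matrix (Fin n) (Fin m) 𝔸) :
    (BetaRiesz.HasDensity P R₁ (BetaRiesz.matVol 𝔸 n m)
        (BetaRiesz.pearsonRieszDensityI a κ₁ τ₁) →
      (∀ᵐ ω ∂P, BetaRiesz.PosDef (R₁ ω * (R₁ ω)ᴴ)) ∧
      BetaRiesz.HasDensity P (fun ω => R₁ ω * (R₁ ω)ᴴ) (BetaRiesz.hermVol 𝔸 n)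
        (BetaRiesz.cBetaRieszDensity m a κ₁ τ₁)) ∧
    (BetaRiesz.HasDensity P R₁ (BetaRiesz.matVol 𝔸 n m)
        (BetaRiesz.pearsonRieszDensityII a κ₁ τ₁) →
      (∀ᵐ ω ∂P, BetaRiesz.PosDef (R₁ ω * (R₁ ω)ᴴ)) ∧
      BetaRiesz.HasDensity P (fun ω => R₁ ω * (R₁ ω)ᴴ) (BetaRiesz.hermVol 𝔸 n)
        (BetaRiesz.kBetaRieszDensity m a κ₁ τ₁)) := by
  have hsub : Measurable fun B : Matrix (Fin n) (Fin n) 𝔸 => 1 - B :=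
    (continuous_const.sub continuous_id).measurable
  constructor
  -- The inverse beta constant is absorbed into `w`, so neither its value nor its positivity is
  -- needed.
  · refine BetaRiesz.HasDensity.mul_conjTranspose hnm.le h𝔸 (w := fun B =>
      (BetaRiesz.cBeta 𝔸 (a * BetaRiesz.beta 𝔸 / 2) κ₁ (m * BetaRiesz.beta 𝔸 / 2) τ₁)⁻¹ *
      BetaRiesz.hdet (1 - B) ^ ((a - n + 1) * BetaRiesz.beta 𝔸 / 2 - 1) *
      BetaRiesz.q κ₁ (1 - B) * BetaRiesz.q τ₁ B) ?_ (fun R => ?_) (fun B => ?_)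
    · exact ((measurable_const.mul (((BetaRiesz.measurable_hdet n).comp hsub).pow_const _)).mul
        ((BetaRiesz.measurable_q κ₁).comp hsub)).mul (BetaRiesz.measurable_q τ₁)
    · rw [BetaRiesz.pearsonRieszDensityI]
      split_ifs
      swap; · rfl
      rw [div_mul_eq_div_mul_one_div, one_div]
      ring
    · rw [BetaRiesz.cBetaRieszDensity]
      split_ifs
      swap; · rfl
      rw [div_eq_mul_inv]
      ring
  -- `minv` is defined by choice; `g` is a measurable substitute that agrees with it wherever the
  -- densities are not set to 0.
  · obtain ⟨g, hg, hgm⟩ := BetaRiesz.exists_measurable_minv 𝔸 n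
    refine BetaRiesz.HasDensity.mul_conjTranspose hnm.le h𝔸 (w := fun B =>
      (BetaRiesz.kBeta 𝔸 (a * BetaRiesz.beta 𝔸 / 2) κ₁ (m * BetaRiesz.beta 𝔸 / 2) τ₁)⁻¹ *
      BetaRiesz.hdet (1 - B) ^ ((a - n + 1) * BetaRiesz.beta 𝔸 / 2 - 1) *
      BetaRiesz.q κ₁ (g (1 - B)) * BetaRiesz.q τ₁ (g B)) ?_ (fun R => ?_) (fun B => ?_)
    · exact ((measurable_const.mul (((BetaRiesz.measurable_hdet n).comp hsub).pow_const _)).mul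
        ((BetaRiesz.measurable_q κ₁).comp (hg.comp hsub))).mul
          ((BetaRiesz.measurable_q τ₁).comp hg)
    · rw [BetaRiesz.pearsonRieszDensityII]
      split_ifs with hP
      swap; · rfl
      rw [div_mul_eq_div_mul_one_div, one_div, hgm _ hP.1, hgm _ hP.2]
      ring
    · rw [BetaRiesz.kBetaRieszDensity]
      split_ifs with hP
      swap; · rfl
      rw [div_eq_mul_inv, hgm _ hP.1, hgm _ hP.2]
      ring
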